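/- Let $(\mathcal X,d)$ be a metric space whose topology is Polish (for instance a complete separable metric space), with its Borel $\sigma$-field, and let $\mathcal P(\mathcal X)$ be the set of its Borel probability measures. For $c:\mathcal X\times\mathcal X\to\mathbb R^+$ and $\nu,\mu\in\mathcal P(\mathcal X)$ let $\mathcal T_c(\nu,\mu)=\inf_\pi\int c\,d\pi\in[0,+\infty]$, where $\pi$ runs over the probability measures on $\mathcal X\times\mathcal X$ with first marginal $\nu$ and second marginal $\mu$. Let $H(\nu|\mu)=\int\log\frac{d\nu}{d\mu}\,d\nu$ if $\nu\ll\mu$, and $H(\nu|\mu)=+\infty$ otherwise. Let $\mathcal C$ be the set of convex lower semicontinuous functions $\alpha:\mathbb R^+\to[0,+\infty]$ with $\alpha(0)=0$. For $\alpha\in\mathcal C$ put $\alpha(+\infty)=\sup\alpha$, $\alpha^{\circledast}(s)=\sup_{t\ge0}\{st-\alpha(t)\}$ for $s\ge0$, and $\tau_\alpha=e^{\alpha}-1$. For nondecreasing $\varphi:\mathbb R^+\to[0,+\infty]$ put $\varphi^{-1}(y)=\sup\{t\ge0:\varphi(t)\le y\}$. Let $L_{\tau_\alpha}(\mu)$ be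 the set of measurable $f:\mathcal X\to\mathbb R$ such that $\int\tau_\alpha(|f|/\lambda)\,d\mu<+\infty$ for some $\lambda>0$, and let $\|f\|_{\tau_\alpha}=\inf\{\lambda>0:\int\tau_\alpha(|f|/\lambda)\,d\mu\le1\}$. Consider the assumptions: * $(A_1)$: $\{s\ge 0:\alpha^{\circledast}(s)<+\infty\}=[0,b[$ for some $b\in\,]0,+\infty]$; * $(A_2)$: there are $s_0>0$ and $\kappa>0$ such that $\alpha^{\circledast}(s)\ge \kappa s^2$ for all $s\in[0,s_0]$. **Theorem.** Let $c(x,y)=q(d(x,y))$, where $q:\mathbb R^+\to\mathbb R^+$ is nondecreasing and convex, $q(0)=0$, and $q$ satisfies the $\Delta_2$-condition: there is $K>0$ with $q(2x)\le Kq(x)$ for all $x\ge0$. Let $\alpha\in\mathcal C$ satisfy $(A_1)$ and $(A_2)$, and let $\mu\in\mathcal P(\mathcal X)$ be such that $\int c(x_0,x)\,d\mu(x)<+\infty$ for all $x_0\in\mathcal X$. Then the following are equivalent: 1. there is $a\in\,]0,+\infty[$ such that $\alpha\left(\frac{\mathcal T_c(\nu,\mu)}{a}\right)\le H(\nu|\mu)$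 for all $\nu\in\mathcal P(\mathcal X)$; 2. $c(x_0,\cdot)\in L_{\tau_\alpha}(\mu)$ for all $x_0\in\mathcal X$. More precisely, let $K$ be any constant in the $\Delta_2$-condition, $s_0,\kappa$ any constants in $(A_2)$, $u$ any number in $]0,1[$ with $\frac{u}{\sqrt{1-u}}\le s_0\sqrt{\kappa}$ and $\frac{u^3}{1-u}\le2$, and $$m_\alpha=e\,\max\left(\frac1{(\alpha^{\circledast})^{-1}(2)\,\sqrt{\kappa(1-u)}},\ \frac1u\right).$$ If (2) holds, then the number $a=\sqrt2\,K\,m_\alpha\,\inf_{x_0\in\mathcal X}\|c(x_0,\cdot)\|_{\tau_\alpha}$ is finite and the inequality in (1) holds for all $\nu\in\mathcal P(\mathcal X)$ with this $a$ (if $a=0$, then $\mathcal T_c(\nu,\mu)/a$ is read as $0$ when $\mathcal T_c(\nu,\mu)=0$ and as $+\infty$ otherwise). Furthermore, if $\alpha(t)<+\infty$ for all $t\ge0$, then for all $\nu\in\mathcal P(\mathcal X)$ $$\mathcal T_c(\nu,\mu)\le\sqrt2\,K\,m_\alpha\inf_{x_0\in\mathcal X,\ \delta>0}\left\{\frac1\delta\left(1+\frac{\log\int_{\mathcal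 X}e^{\alpha(\delta c(x_0,x))}\,d\mu(x)}{\log2}\right)\alpha^{-1}\big(H(\nu|\mu)\big)\right\},$$ where $0\cdot(+\infty)=0$ and $\alpha^{-1}(+\infty)=+\infty$. -/

import Mathlib

open MeasureTheory
open scoped ENNReal NNReal

namespace TransportCost

noncomputable section

/-- The class of convex lower semicontinuous functions `α : ℝ₊ → ℝ₊ ∪ {+∞}` with `α 0 = 0`. -/
structure ConvexClass (α : ℝ≥0 → ℝ≥0∞) : Prop where
  convexOn : ConvexOn ℝ≥0 Set.univ α
  lowerSemicontinuous : LowerSemicontinuous α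
  map_zero : α 0 = 0

/-- The monotone convex conjugate `α^⊛(s) = sup_{t ≥ 0} (s t - α t)`. The subtraction is truncated
at `0`; this does not change the supremum when `α 0 = 0`, because `t = 0` contributes `0`. -/
def conj (α : ℝ≥0 → ℝ≥0∞) (s : ℝ≥0) : ℝ≥0∞ :=
  ⨆ t : ℝ≥0, ((s * t : ℝ≥0) : ℝ≥0∞) - α t

/-- The effective domain of `α^⊛` is `[0, b[` for some `b ∈ ]0, +∞]`. -/
def AssumptionA1 (α : ℝ≥0 → ℝ≥0∞) : Prop :=
  ∃ b : ℝ≥0∞, 0 < b ∧ ∀ s : ℝ≥0, conj α s < ⊤ ↔ (s : ℝ≥0∞) < b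

/-- `α^⊛` is super-quadratic near `0`, with constants `s₀` and `κ`. -/
def SuperQuadraticWith (α : ℝ≥0 → ℝ≥0∞) (s₀ κ : ℝ) : Prop :=
  0 < s₀ ∧ 0 < κ ∧ ∀ s : ℝ≥0, (s : ℝ) ≤ s₀ → ENNReal.ofReal (κ * (s : ℝ) ^ 2) ≤ conj α s

/-- `α^⊛` is super-quadratic near `0`. -/
def AssumptionA2 (α : ℝ≥0 → ℝ≥0∞) : Prop :=
  ∃ s₀ κ : ℝ, SuperQuadraticWith α s₀ κ

/-- The `Δ₂`-condition with constant `K`. -/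
def Delta2With (q : ℝ≥0 → ℝ≥0) (K : ℝ) : Prop :=
  0 < K ∧ ∀ x : ℝ≥0, (q (2 * x) : ℝ) ≤ K * q x

/-- The inverse `φ⁻¹(y) = sup {t ≥ 0 | φ t ≤ y}` of a nondecreasing `φ`
(`+∞` if `φ ≤ y` everywhere). -/
def genInv (φ : ℝ≥0 → ℝ≥0∞) (y : ℝ≥0∞) : ℝ≥0∞ :=
  ⨆ t : ℝ≥0, ⨆ _ : φ t ≤ y, (t : ℝ≥0∞)

/-- The value of a nondecreasing `α` at a point of `[0, +∞]`, with `α(+∞) = sup α`. -/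
def extend (α : ℝ≥0 → ℝ≥0∞) (x : ℝ≥0∞) : ℝ≥0∞ :=
  if x = ⊤ then ⨆ t : ℝ≥0, α t else α x.toNNReal

/-- `e^{α t}`, with `e^{+∞} = +∞`. -/
def expOf (α : ℝ≥0 → ℝ≥0∞) (t : ℝ≥0) : ℝ≥0∞ := EReal.exp ((α t : ℝ≥0∞) : EReal)

/-- `τ_α = e^α - 1`. -/
def tau (α : ℝ≥0 → ℝ≥0∞) (t : ℝ≥0) : ℝ≥0∞ := expOf α t - 1

variable {X : Type*} [MeasurableSpace X]

/-- `f` belongs to the Orlicz space `L_{τ_α}(X, μ)`. -/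
def MemOrlicz (α : ℝ≥0 → ℝ≥0∞) (μ : Measure X) (f : X → ℝ) : Prop :=
  AEMeasurable f μ ∧ ∃ l : ℝ≥0, 0 < l ∧ ∫⁻ x, tau α (‖f x‖₊ / l) ∂μ < ⊤

/-- The Luxemburg norm `‖f‖_{τ_α}` (`+∞` if no admissible constant exists). -/
def luxNorm (α : ℝ≥0 → ℝ≥0∞) (μ : Measure X) (f : X → ℝ) : ℝ≥0∞ :=
  ⨅ l : ℝ≥0, ⨅ _ : 0 < l ∧ ∫⁻ x, tau α (‖f x‖₊ / l) ∂μ ≤ 1, (l : ℝ≥0∞)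

/-- The optimal transportation cost `T_c(ν, μ)`, an infimum over all couplings `π` with first
marginal `ν` and second marginal `μ`. -/
def optCost (c : X → X → ℝ≥0) (ν μ : Measure X) : ℝ≥0∞ :=
  ⨅ π : Measure (X × X), ⨅ _ : π.fst = ν ∧ π.snd = μ, ∫⁻ p, (c p.1 p.2 : ℝ≥0∞) ∂π

/-- The transport inequality `α(T_c(ν, μ) / a) ≤ H(ν | μ)` for all probability measures `ν`.
The quotient is taken in `[0, +∞]`: for `a = 0` it is `0` if `T_c(ν, μ) = 0` and `+∞` otherwise. -/
def TransportInequality (α : ℝ≥0 → ℝ≥0∞) (c : X → X → ℝ≥0) (μ : Measure X) (a : ℝ≥0∞) : Prop :=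
  ∀ ν : Measure X, IsProbabilityMeasure ν →
    extend α (optCost c ν μ / a) ≤ InformationTheory.klDiv ν μ

/-- `m_α = e · max (1 / ((α^⊛)⁻¹(2) √(κ (1 - u)))) (1 / u)`. -/
def mConst (α : ℝ≥0 → ℝ≥0∞) (κ u : ℝ) : ℝ≥0∞ :=
  ENNReal.ofReal (Real.exp 1) *
    max (1 / (genInv (conj α) 2 * ENNReal.ofReal √(κ * (1 - u)))) (1 / ENNReal.ofReal u)

/-- The restrictions on the auxiliary parameter `u` of `mConst`. -/
def AdmissibleParam (s₀ κ u : ℝ) : Prop :=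
  0 < u ∧ u < 1 ∧ u / √(1 - u) ≤ s₀ * √κ ∧ u ^ 3 / (1 - u) ≤ 2

/-- `(1 / δ) (1 + log (∫ e^{α(δ χ)} dμ) / log 2)`, which is `+∞` if the integral is infinite.
For a probability measure `μ` the integral is at least `1`, so that its logarithm is nonnegative. -/
def expBound (α : ℝ≥0 → ℝ≥0∞) (μ : Measure X) (χ : X → ℝ≥0) (δ : ℝ≥0) : ℝ≥0∞ :=
  1 / (δ : ℝ≥0∞) *
    (1 + (ENNReal.log (∫⁻ x, expOf α (δ * χ x) ∂μ)).toENNReal / ENNReal.ofReal (Real.log 2))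

end

end TransportCost

/-! Sufficiency of the Orlicz condition combines three bounds. First, a coupling that leaves the
common mass of ν and μ in place and moves the rest by a product measure, together with the
quasi-triangle inequality c(x,y) ≤ (K/2)(c(x₀,x) + c(x₀,y)), bounds the cost by K/2 times the
integral of c(x₀,·) against |ν - μ| (`optCost_le_mul_lintegral_absDensity`).

Second, a weighted Pinsker inequality. Let χ = c(x₀,·)/L with ∫ e^{α(χ)} dμ ≤ 2. Young's inequality
st ≤ α(t) + α^⊛(s) gives ∫ e^{t|f|} dμ ≤ 2e^{α^⊛(t)} for |f| ≤ χ. For g = (f - ∫f dμ)/2 this is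
upgraded to log ∫ e^{sg} dμ ≤ α^⊛(Cs) with C = √2 m_α (`log_integral_exp_le`): the factor 2 has to
be absorbed, which centring allows for small s and convexity of α^⊛ for large s. Donsker–Varadhan
duality then gives sV/2 ≤ H(ν|μ) + α^⊛(Cs), where V is the integral of χ against |ν - μ|.

Third, Fenchel–Moreau duality (`ConvexClass.le_of_forall_conj`) turns this family of linear bounds
into α(V/(2C)) ≤ H(ν|μ). Since the cost is at most KLV/2, this is the transport inequality with a =
KLC. The exponential-moment bound follows because `expBound` is itself an admissible L
(`exists_eq_expBound`).

Necessity is a concentration argument: testing the inequality on the conditional measures μ(·|S),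
whose entropy is at most -log μ(S), gives exponential tails (`measure_le_exp_neg`), and these sum to
an exponential moment after halving the argument. -/

namespace TransportCost

/-! ### Convex conjugates on the half-line and the level (α^⊛)⁻¹(2). -/

section ConvexFunctions

variable {α : ℝ≥0 → ℝ≥0∞}

lemma ConvexClass.le_combo (hα : ConvexClass α) {a b : ℝ≥0} (hab : a + b = 1) (x y : ℝ≥0) :
    α (a * x + b * y) ≤ a * α x + b * α y := by
  have := hα.convexOn.2 (Set.mem_univ x) (Set.mem_univ y) (zero_le (a := a)) (zero_le (a := b)) hab
  simpa [ENNReal.smul_def] using this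

lemma ConvexClass.map_mul_le (hα : ConvexClass α) {θ : ℝ≥0} (hθ : θ ≤ 1) (t : ℝ≥0) :
    α (θ * t) ≤ θ * α t := by
  have := hα.le_combo (add_tsub_cancel_of_le hθ) t 0
  simpa [hα.map_zero] using this

lemma ConvexClass.monotone (hα : ConvexClass α) : Monotone α := by
  intro x y hxy
  rcases eq_or_ne y 0 with rfl | hy
  · simp [nonpos_iff_eq_zero.1 hxy]
  have hθ : x / y ≤ 1 := div_le_one_of_le₀ hxy zero_le
  calc α x = α (x / y * y) := by rw [div_mul_cancel₀ _ hy]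
    _ ≤ ((x / y : ℝ≥0) : ℝ≥0∞) * α y := hα.map_mul_le hθ y
    _ ≤ 1 * α y := by gcongr; exact_mod_cast hθ
    _ = α y := one_mul _

/-- Young's inequality, in additive form so that infinite values need no separate treatment. -/
lemma mul_le_add_conj (α : ℝ≥0 → ℝ≥0∞) (s t : ℝ≥0) :
    ((s * t : ℝ≥0) : ℝ≥0∞) ≤ α t + conj α s := by
  have : ((s * t : ℝ≥0) : ℝ≥0∞) - α t ≤ conj α s :=
    le_iSup (fun t : ℝ≥0 => ((s * t : ℝ≥0) : ℝ≥0∞) - α t) t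
  exact tsub_le_iff_left.1 this

lemma conj_le_iff (α : ℝ≥0 → ℝ≥0∞) (s : ℝ≥0) (b : ℝ≥0∞) :
    conj α s ≤ b ↔ ∀ t : ℝ≥0, ((s * t : ℝ≥0) : ℝ≥0∞) ≤ α t + b := by
  simp only [conj, iSup_le_iff, tsub_le_iff_left]

lemma conj_mono (α : ℝ≥0 → ℝ≥0∞) : Monotone (conj α) := by
  intro s s' h
  rw [conj_le_iff]
  intro t
  refine le_trans ?_ (mul_le_add_conj α s' t)
  gcongr

lemma conj_mul_le (α : ℝ≥0 → ℝ≥0∞) {θ : ℝ≥0} (hθ : θ ≤ 1) (s : ℝ≥0) :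
    conj α (θ * s) ≤ θ * conj α s := by
  rw [conj_le_iff]
  intro t
  calc ((θ * s * t : ℝ≥0) : ℝ≥0∞) = θ * ((s * t : ℝ≥0) : ℝ≥0∞) := by push_cast; ring
    _ ≤ θ * (α t + conj α s) := by gcongr; exact mul_le_add_conj α s t
    _ = θ * α t + θ * conj α s := mul_add _ _ _
    _ ≤ 1 * α t + θ * conj α s := by gcongr; exact_mod_cast hθ
    _ = α t + θ * conj α s := by rw [one_mul]

lemma mul_conj_le_conj_mul (α : ℝ≥0 → ℝ≥0∞) {C : ℝ≥0} (hC : 1 ≤ C) (s : ℝ≥0) :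
    C * conj α s ≤ conj α (C * s) := by
  have hC0 : C ≠ 0 := (zero_lt_one.trans_le hC).ne'
  have h := conj_mul_le α (θ := C⁻¹) (inv_le_one_of_one_le₀ hC) (C * s)
  rw [inv_mul_cancel_left₀ hC0] at h
  calc C * conj α s ≤ C * ((C⁻¹ : ℝ≥0) * conj α (C * s)) := by gcongr
    _ = conj α (C * s) := by
      rw [← mul_assoc, ← ENNReal.coe_mul, mul_inv_cancel₀ hC0, ENNReal.coe_one, one_mul]

/-- As a supremum of linear functions, α^⊛ is lower semicontinuous, so its sublevel sets are closed
and the endpoint s = (α^⊛)⁻¹(b) is included. -/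
lemma conj_le_of_le_genInv {b : ℝ≥0∞} {s : ℝ≥0} (hs : (s : ℝ≥0∞) ≤ genInv (conj α) b) :
    conj α s ≤ b := by
  rw [conj_le_iff]
  intro t
  by_contra! hlt
  have ht : t ≠ 0 := by rintro rfl; simp at hlt
  obtain ⟨z, hz, hz'⟩ := ENNReal.lt_iff_exists_nnreal_btwn.1 hlt
  have hz' : z < s * t := by exact_mod_cast hz'
  have h1 : ((z / t : ℝ≥0) : ℝ≥0∞) < genInv (conj α) b := by
    refine lt_of_lt_of_le ?_ hs
    exact_mod_cast (div_lt_iff₀ (pos_iff_ne_zero.2 ht)).2 hz'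
  obtain ⟨r, hr⟩ := lt_iSup_iff.1 h1
  obtain ⟨hr, hr'⟩ := lt_iSup_iff.1 hr
  have hr' : z / t < r := by exact_mod_cast hr'
  have hzr : z ≤ r * t := ((div_lt_iff₀ (pos_iff_ne_zero.2 ht)).1 hr').le
  have : (z : ℝ≥0∞) ≤ α t + b := calc
    (z : ℝ≥0∞) ≤ ((r * t : ℝ≥0) : ℝ≥0∞) := by exact_mod_cast hzr
    _ ≤ α t + conj α r := mul_le_add_conj α r t
    _ ≤ α t + b := by gcongr
  exact absurd hz (not_lt.2 this)

lemma le_of_genInv_lt {φ : ℝ≥0 → ℝ≥0∞} {b : ℝ≥0∞} {s : ℝ≥0} (hs : genInv φ b < s) :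
    b ≤ φ s := by
  by_contra! h
  refine absurd hs (not_lt.2 ?_)
  exact le_iSup₂_of_le (f := fun (t : ℝ≥0) (_ : φ t ≤ b) => (t : ℝ≥0∞)) s h.le le_rfl

lemma le_genInv {φ : ℝ≥0 → ℝ≥0∞} {b : ℝ≥0∞} {s : ℝ≥0} (hs : φ s ≤ b) :
    (s : ℝ≥0∞) ≤ genInv φ b :=
  le_iSup₂_of_le (f := fun (t : ℝ≥0) (_ : φ t ≤ b) => (t : ℝ≥0∞)) s hs le_rfl

/-- Supporting lines of `α` from below: one half of the Fenchel–Moreau theorem. -/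
lemma ConvexClass.le_of_forall_conj (hα : ConvexClass α) {ρ : ℝ≥0} {H : ℝ≥0∞}
    (h : ∀ s : ℝ≥0, ((s * ρ : ℝ≥0) : ℝ≥0∞) ≤ H + conj α s) : α ρ ≤ H := by
  by_contra! hlt
  obtain ⟨a, haH, haα⟩ := ENNReal.lt_iff_exists_nnreal_btwn.1 hlt
  have hρ : 0 < ρ := by
    rw [pos_iff_ne_zero]
    rintro rfl
    simp [hα.map_zero] at hlt
  -- Lower semicontinuity keeps α above a slightly to the left of ρ; this gap bounds the slopes
  -- below.
  obtain ⟨y, hyρ, hy⟩ : ∃ y < ρ, ∀ t, y < t → (a : ℝ≥0∞) < α t := by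
    have h1 := hα.lowerSemicontinuous ρ a haα
    have h2 : ∀ᶠ t in nhdsWithin ρ (Set.Iio ρ), (a : ℝ≥0∞) < α t := nhdsWithin_le_nhds h1
    have : (nhdsWithin ρ (Set.Iio ρ)).NeBot := nhdsWithin_Iio_neBot' ⟨0, hρ⟩ le_rfl
    obtain ⟨y, hy, hy'⟩ := (h2.and self_mem_nhdsWithin).exists
    exact ⟨y, hy', fun t ht => hy.trans_le (hα.monotone ht.le)⟩
  -- Slopes of lines through (ρ, a), where H < a < α ρ, that pass on or above the graph of α at some
  -- point left of ρ. The line with the supremal slope lies below α everywhere, which is `key`.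
  let S : Set ℝ := {r | 0 ≤ r ∧ ∃ t : ℝ≥0, t < ρ ∧ α t ≤ a ∧ r * (ρ - t) + (α t).toReal ≤ a}
  have hS_ne : S.Nonempty := by
    refine ⟨0, le_rfl, 0, hρ, by simp [hα.map_zero], by simp [hα.map_zero]⟩
  have hyρ' : (y : ℝ) < ρ := hyρ
  have hS_bdd : BddAbove S := by
    refine ⟨a / (ρ - y), ?_⟩
    rintro r ⟨hr, t, ht, hta, hrt⟩
    have hty : t ≤ y := by
      by_contra! hc
      exact absurd (hy t hc) (not_lt.2 hta)
    have hty' : (t : ℝ) ≤ y := hty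
    rw [le_div_iff₀ (by linarith)]
    have : 0 ≤ (α t).toReal := ENNReal.toReal_nonneg
    nlinarith
  set s : ℝ := sSup S with hs
  have hs0 : 0 ≤ s := by
    obtain ⟨r, hr⟩ := hS_ne
    exact hr.1.trans (le_csSup hS_bdd hr)
  have key : ∀ t : ℝ≥0, α t ≠ ⊤ → (a : ℝ) + s * t ≤ (α t).toReal + s * ρ := by
    intro t ht
    rcases lt_trichotomy t ρ with htρ | rfl | htρ
    · have htρ' : (t : ℝ) < ρ := htρ
      rcases le_total (a : ℝ≥0∞) (α t) with hat | hat
      · have : (a : ℝ) ≤ (α t).toReal := by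
          simpa using ENNReal.toReal_mono ht hat
        nlinarith
      · have hat' : (α t).toReal ≤ a := by simpa using ENNReal.toReal_mono ENNReal.coe_ne_top hat
        have hmem : (a - (α t).toReal) / (ρ - t) ∈ S := by
          refine ⟨div_nonneg (by linarith) (by linarith), t, htρ, hat, ?_⟩
          rw [div_mul_cancel₀ _ (by linarith)]
          linarith
        have := le_csSup hS_bdd hmem
        rw [div_le_iff₀ (by linarith)] at this
        linarith
    · have : (a : ℝ) ≤ (α t).toReal := by simpa using ENNReal.toReal_mono ht haα.le
      linarith
    · have htρ' : (ρ : ℝ) < t := htρ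
      by_contra! hc
      have h1 : ((α t).toReal - a) / (t - ρ) < s := by
        rw [div_lt_iff₀ (by linarith)]
        linarith
      -- The line of slope r through (ρ, a) would dominate α at t' < ρ and at t > ρ, so convexity
      -- would force α ρ ≤ a.
      obtain ⟨r, ⟨hr0, t', ht', hta', hr⟩, hlt'⟩ := exists_lt_of_lt_csSup hS_ne h1
      rw [div_lt_iff₀ (by linarith)] at hlt'
      have htt : (t' : ℝ) < ρ := ht'
      have hd : (0 : ℝ) < t - t' := by linarith
      have hαt' : α t' ≠ ⊤ := ne_top_of_le_ne_top ENNReal.coe_ne_top hta'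
      have hd' : t - t' ≠ 0 := (tsub_pos_of_lt (ht'.trans htρ)).ne'
      have c1 : ((t - t' : ℝ≥0) : ℝ) = t - t' := NNReal.coe_sub (ht'.trans htρ).le
      have c2 : ((t - ρ : ℝ≥0) : ℝ) = t - ρ := NNReal.coe_sub htρ.le
      have c3 : ((ρ - t' : ℝ≥0) : ℝ) = ρ - t' := NNReal.coe_sub ht'.le
      have hconv := hα.le_combo (a := (t - ρ) / (t - t')) (b := (ρ - t') / (t - t'))
        (by
          rw [← NNReal.coe_inj]; push_cast [c1, c2, c3]
          field_simp; ring) t' t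
      have harg : (t - ρ) / (t - t') * t' + (ρ - t') / (t - t') * t = ρ := by
        rw [← NNReal.coe_inj]; push_cast [c1, c2, c3]
        field_simp; ring
      rw [harg] at hconv
      have h2 := haα.trans_le hconv
      have hfin : ((t - ρ) / (t - t') : ℝ≥0) * α t' + ((ρ - t') / (t - t') : ℝ≥0) * α t ≠ ⊤ :=
        ENNReal.add_ne_top.2
          ⟨ENNReal.mul_ne_top ENNReal.coe_ne_top hαt', ENNReal.mul_ne_top ENNReal.coe_ne_top ht⟩
      have h3 := (ENNReal.toReal_lt_toReal ENNReal.coe_ne_top hfin).2 h2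
      rw [ENNReal.toReal_add (ENNReal.mul_ne_top ENNReal.coe_ne_top hαt')
        (ENNReal.mul_ne_top ENNReal.coe_ne_top ht), ENNReal.toReal_mul, ENNReal.toReal_mul] at h3
      simp only [ENNReal.coe_toReal, NNReal.coe_div, c1, c2, c3] at h3
      rw [div_mul_eq_mul_div, div_mul_eq_mul_div, ← add_div, lt_div_iff₀ hd] at h3
      nlinarith [mul_le_mul_of_nonneg_left hr (sub_nonneg.2 htρ'.le),
        mul_le_mul_of_nonneg_left hlt'.le (sub_nonneg.2 htt.le)]
  lift s to ℝ≥0 using hs0 with s' hs'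
  have hasρ : a ≤ s' * ρ := by
    have := key 0 (by simp [hα.map_zero])
    simp only [hα.map_zero, NNReal.coe_zero, mul_zero, add_zero, ENNReal.toReal_zero, zero_add]
      at this
    exact_mod_cast this
  have hconj : conj α s' ≤ ((s' * ρ - a : ℝ≥0) : ℝ≥0∞) := by
    rw [conj_le_iff]
    intro t
    rcases eq_or_ne (α t) ⊤ with ht | ht
    · simp [ht]
    have := key t ht
    lift α t to ℝ≥0 using ht with v
    rw [← ENNReal.coe_add, ENNReal.coe_le_coe, ← NNReal.coe_le_coe]
    push_cast [NNReal.coe_sub hasρ]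
    simp only [ENNReal.coe_toReal] at this
    linarith
  have h4 : ((s' * ρ : ℝ≥0) : ℝ≥0∞) < ((s' * ρ : ℝ≥0) : ℝ≥0∞) := calc
    ((s' * ρ : ℝ≥0) : ℝ≥0∞) ≤ H + conj α s' := h s'
    _ ≤ H + ((s' * ρ - a : ℝ≥0) : ℝ≥0∞) := by gcongr
    _ < a + ((s' * ρ - a : ℝ≥0) : ℝ≥0∞) := by
      exact ENNReal.add_lt_add_right ENNReal.coe_ne_top haH
    _ = ((s' * ρ : ℝ≥0) : ℝ≥0∞) := by
      rw [← ENNReal.coe_add, add_tsub_cancel_of_le hasρ]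
  exact lt_irrefl _ h4

/-- α^⊛ is finite at some s > 0, and shrinking s by a factor θ shrinks the value by at least θ. -/
lemma genInv_conj_ne_zero (hA1 : AssumptionA1 α) : genInv (conj α) 2 ≠ 0 := by
  obtain ⟨b, hb, h⟩ := hA1
  obtain ⟨s, hs0, hsb⟩ := ENNReal.lt_iff_exists_nnreal_btwn.1 hb
  have hs0 : 0 < s := by exact_mod_cast hs0
  have hfin := (h s).2 hsb
  lift conj α s to ℝ≥0 using hfin.ne with v hv
  have hθ : (v + 1)⁻¹ ≤ 1 := inv_le_one_of_one_le₀ (by simp)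
  have h1 : conj α ((v + 1)⁻¹ * s) ≤ 2 := by
    refine (conj_mul_le α hθ s).trans ?_
    rw [← hv, ← ENNReal.coe_mul]
    have : (v + 1)⁻¹ * v ≤ 2 := by
      rw [inv_mul_le_iff₀ (by positivity)]
      nlinarith [zero_le (a := v)]
    exact_mod_cast this
  have h2 := le_genInv h1
  intro h0
  rw [h0, nonpos_iff_eq_zero, ENNReal.coe_eq_zero] at h2
  have : 0 < (v + 1)⁻¹ * s := by positivity
  exact this.ne' h2

/-- α^⊛ is positive at s₀ and grows at least linearly from there, so it exceeds 2. -/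
lemma genInv_conj_ne_top {s₀ κ : ℝ} (h : SuperQuadraticWith α s₀ κ) : genInv (conj α) 2 ≠ ⊤ := by
  obtain ⟨hs0, hκ, h⟩ := h
  intro htop
  lift s₀ to ℝ≥0 using hs0.le
  have h0 := h s₀ le_rfl
  have hpos : 0 < κ * (s₀ : ℝ) ^ 2 := by positivity
  set w : ℝ≥0 := ⟨κ * (s₀ : ℝ) ^ 2, hpos.le⟩ with hw
  have hwpos : 0 < w := hpos
  have hw' : ENNReal.ofReal (κ * (s₀ : ℝ) ^ 2) = w := ENNReal.ofReal_eq_coe_nnreal hpos.le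
  rw [hw'] at h0
  have h1 := mul_conj_le_conj_mul α (C := 3 / w + 1) (by simp) s₀
  have h2 : conj α ((3 / w + 1) * s₀) ≤ 2 := conj_le_of_le_genInv (by rw [htop]; exact le_top)
  have h3 : (((3 / w + 1) * w : ℝ≥0) : ℝ≥0∞) ≤ (2 : ℝ≥0) := by
    push_cast
    refine le_trans ?_ (h1.trans h2)
    push_cast
    gcongr
  rw [ENNReal.coe_le_coe, add_mul, div_mul_cancel₀ _ hwpos.ne'] at h3
  have : (3 : ℝ≥0) ≤ 2 := le_trans (by simp) h3
  norm_num at this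

end ConvexFunctions

/-! ### Comparison of the two Laplace bounds with α^⊛(Cs). -/

section Numerics

variable {α : ℝ≥0 → ℝ≥0∞}

/-- Compare power series: the terms of order at least 2 carry a factor xⁿ ≤ x². The linear term is
kept exact so that it vanishes for centred functions. -/
lemma exp_mul_le_of_le_one {x : ℝ} (hx0 : 0 ≤ x) (hx1 : x ≤ 1) (y : ℝ) :
    Real.exp (x * y) ≤ 1 + x * y + x ^ 2 * Real.exp |y| := by
  have hs (z : ℝ) : HasSum (fun n : ℕ => z ^ n / (n.factorial : ℝ)) (Real.exp z) := by
    rw [Real.exp_eq_exp_ℝ]; exact NormedSpace.expSeries_div_hasSum_exp z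
  have h0 : HasSum (fun n : ℕ => if n = 0 then (1 : ℝ) else 0) 1 := hasSum_ite_eq 0 1
  have h1 : HasSum (fun n : ℕ => if n = 1 then x * y else 0) (x * y) := hasSum_ite_eq 1 (x * y)
  refine hasSum_le (fun n => ?_) (hs (x * y)) ((h0.add h1).add ((hs |y|).mul_left (x ^ 2)))
  rcases n with _ | _ | n
  · simp [sq_nonneg]
  · simp; positivity
  · simp only [if_false, Nat.add_eq_right, Nat.succ_ne_zero, zero_add]
    rw [← mul_div_assoc]
    gcongr
    calc (x * y) ^ (n + 1 + 1) ≤ |(x * y) ^ (n + 1 + 1)| := le_abs_self _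
      _ = x ^ (n + 2) * |y| ^ (n + 2) := by rw [abs_pow, abs_mul, abs_of_nonneg hx0, mul_pow]
      _ ≤ x ^ 2 * |y| ^ (n + 2) := by
        gcongr ?_ * _
        exact pow_le_pow_of_le_one hx0 hx1 (by omega)

lemma div_mul_le_toReal_conj {t r : ℝ≥0} {v : ℝ} (ht : 0 < t) (htr : t ≤ r)
    (hfin : conj α r ≠ ⊤) (hv : ENNReal.ofReal v ≤ conj α t) :
    (r : ℝ) / t * v ≤ (conj α r).toReal := by
  have h1 := mul_conj_le_conj_mul α (C := r / t) ((one_le_div ht).2 htr) t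
  rw [div_mul_cancel₀ _ ht.ne'] at h1
  have h2 : ENNReal.ofReal ((r : ℝ) / t * v) ≤ conj α r := by
    rw [ENNReal.ofReal_mul (by positivity)]
    refine le_trans ?_ h1
    gcongr
    rw [← NNReal.coe_div, ENNReal.ofReal_coe_nnreal]
  exact (ENNReal.ofReal_le_iff_le_toReal hfin).1 h2

lemma toReal_conj_le_div_mul {s t : ℝ≥0} {v : ℝ} (hv0 : 0 ≤ v) (ht : 0 < t) (hst : s ≤ t)
    (hv : conj α t ≤ ENNReal.ofReal v) : (conj α s).toReal ≤ s / t * v := by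
  have hfin : conj α t ≠ ⊤ := ne_top_of_le_ne_top ENNReal.ofReal_ne_top hv
  have h := conj_mul_le α (θ := s / t) ((div_le_one ht).2 hst) t
  rw [div_mul_cancel₀ _ ht.ne'] at h
  have h2 := ENNReal.toReal_mono (ENNReal.mul_ne_top ENNReal.coe_ne_top hfin) h
  rw [ENNReal.toReal_mul, ENNReal.coe_toReal, NNReal.coe_div] at h2
  refine h2.trans ?_
  gcongr
  exact ENNReal.toReal_le_of_le_ofReal hv0 hv

/-- Beyond s₁, convexity keeps α^⊛ above the line through 0 and (s₁, 2). The bound α^⊛ ≥ 2 is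
available only strictly to the right of s₁, hence the auxiliary point t close to s₁. -/
lemma two_mul_div_le_toReal_conj {s₁ r : ℝ≥0} (h₁ : genInv (conj α) 2 = s₁) (hs₁ : 0 < s₁)
    (hr : s₁ < r) (hfin : conj α r ≠ ⊤) : 2 * (r : ℝ) / s₁ ≤ (conj α r).toReal := by
  have hs₁' : (0 : ℝ) < s₁ := hs₁
  by_contra! hc
  have hr' : (s₁ : ℝ) < r := hr
  have hb0 : 0 ≤ (conj α r).toReal := ENNReal.toReal_nonneg
  rw [lt_div_iff₀ hs₁'] at hc
  have hb1 : 0 < (conj α r).toReal := by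
    have h2 : (2 : ℝ≥0∞) ≤ conj α r := le_of_genInv_lt (by rw [h₁]; exact_mod_cast hr)
    refine ENNReal.toReal_pos (ne_of_gt (lt_of_lt_of_le (by norm_num) h2)) hfin
  obtain ⟨t, ht1, ht2⟩ := exists_between (lt_min hr' ((lt_div_iff₀ hb1).2
    (by rw [mul_comm]; exact hc) : (s₁ : ℝ) < 2 * r / (conj α r).toReal))
  have ht0 : 0 ≤ t := hs₁'.le.trans ht1.le
  lift t to ℝ≥0 using ht0
  rw [lt_min_iff] at ht2
  have h2 : ENNReal.ofReal 2 ≤ conj α t := by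
    have : (2 : ℝ≥0∞) ≤ conj α t := le_of_genInv_lt (by rw [h₁]; exact_mod_cast ht1)
    simpa using this
  have ht : (0 : ℝ) < t := hs₁'.trans ht1
  have h3 := div_mul_le_toReal_conj (α := α) (t := t) (r := r) ht
    (by exact_mod_cast ht2.1.le) hfin h2
  have h4 := ht2.2
  rw [lt_div_iff₀ hb1] at h4
  rw [div_mul_eq_mul_div, div_le_iff₀ ht] at h3
  linarith

/-- Here ψ stands for a log-Laplace transform: quadratic up to s₁, and at most log 2 + α^⊛(s)
always. For s > s₁ the dilation by C absorbs log 2. For s ≤ s₁ the lower bound on α^⊛(Cs) is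
quadratic if Cs ≤ s₀, the linear continuation from s₀ if s₀ < Cs ≤ s₁, and the line of slope 2/s₁
beyond s₁. -/
lemma le_toReal_conj_mul {s₀ κ u : ℝ} (hSQ : SuperQuadraticWith α s₀ κ)
    (hu : AdmissibleParam s₀ κ u) {s₁ C s : ℝ≥0} (h₁ : genInv (conj α) 2 = s₁) (hs₁ : 0 < s₁)
    (hC1 : √2 * Real.exp 1 ≤ C * u) (hC2 : √2 * Real.exp 1 ≤ C * (s₁ * √(κ * (1 - u))))
    (hfin : conj α (C * s) ≠ ⊤) {ψ : ℝ}
    (hψ1 : s ≤ s₁ → ψ ≤ 2 * Real.exp 1 ^ 2 * ((s : ℝ) / s₁) ^ 2)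
    (hψ2 : ψ ≤ Real.log 2 + (conj α s).toReal) : ψ ≤ (conj α (C * s)).toReal := by
  obtain ⟨hs0, hκ, hSQ⟩ := hSQ
  obtain ⟨hu0, hu1, hu2, -⟩ := hu
  have he : (2.7 : ℝ) < Real.exp 1 := lt_trans (by norm_num) Real.exp_one_gt_d9
  have he' : Real.exp 1 < 2.72 := lt_trans Real.exp_one_lt_d9 (by norm_num)
  have hr2 : (1.41 : ℝ) < √2 := Real.lt_sqrt_of_sq_lt (by norm_num)
  have hsq2 : √2 * √2 = (2 : ℝ) := Real.mul_self_sqrt (by norm_num)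
  have hlog2 : Real.log 2 < 0.7 := lt_trans Real.log_two_lt_d9 (by norm_num)
  have hs₁' : (0 : ℝ) < s₁ := hs₁
  have hC : (3.8 : ℝ) ≤ C := by
    have h11 : (1.41 : ℝ) * 2.7 ≤ √2 * Real.exp 1 :=
      mul_le_mul hr2.le he.le (by norm_num) (by positivity)
    have h12 : (C : ℝ) * u ≤ C * 1 := mul_le_mul_of_nonneg_left hu1.le C.2
    linarith
  have hC1' : 1 ≤ C := by
    rw [← NNReal.coe_le_coe, NNReal.coe_one]; linarith
  have hsCs : s ≤ C * s := by
    calc s = 1 * s := (one_mul _).symm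
      _ ≤ C * s := by gcongr
  have hfins : conj α s ≠ ⊤ := ne_top_of_le_ne_top hfin (conj_mono α hsCs)
  rcases eq_or_ne s 0 with rfl | hspos
  · have := hψ1 zero_le
    refine this.trans ?_
    simp
  have hspos : (0 : ℝ) < s := NNReal.coe_pos.2 (pos_iff_ne_zero.2 hspos)
  rcases lt_or_ge s₁ s with hlt | hle
  · have hb : 2 * (s : ℝ) / s₁ ≤ (conj α s).toReal := two_mul_div_le_toReal_conj h₁ hs₁ hlt hfins
    have hlt' : (s₁ : ℝ) < s := hlt
    have hb2 : 2 ≤ (conj α s).toReal := by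
      refine le_trans ?_ hb
      rw [le_div_iff₀ hs₁']; linarith
    have hscale := div_mul_le_toReal_conj (α := α) (t := s) (r := C * s)
      (v := (conj α s).toReal) hspos hsCs hfin (by rw [ENNReal.ofReal_toReal hfins])
    rw [NNReal.coe_mul, mul_div_assoc, div_self hspos.ne', mul_one] at hscale
    -- Since C ≥ 3.8 and α^⊛(s) ≥ 2, the excess (C - 1) α^⊛(s) is larger than log 2.
    nlinarith
  set x : ℝ := (s : ℝ) / s₁ with hx
  have hx0 : 0 < x := by positivity
  have hx1 : x ≤ 1 := (div_le_one hs₁').2 hle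
  have hsx : (s : ℝ) = x * s₁ := by rw [hx, div_mul_cancel₀ _ hs₁'.ne']
  have hψ1 := hψ1 hle
  set e := Real.exp 1
  have h1u : 0 < √(1 - u) := Real.sqrt_pos.2 (by linarith)
  have h1u1 : √(1 - u) ≤ 1 := Real.sqrt_le_one.2 (by linarith)
  have hk : 0 < √κ := Real.sqrt_pos.2 hκ
  have hkk : √κ * √κ = κ := Real.mul_self_sqrt hκ.le
  rw [Real.sqrt_mul hκ.le] at hC2
  set k := √κ
  have hC3 : √2 * e ≤ C * (s₁ * k) := by
    refine hC2.trans ?_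
    gcongr
    exact mul_le_of_le_one_right hk.le h1u1
  have hu3 : u ≤ s₀ * k := by
    refine le_trans ?_ hu2
    rw [le_div_iff₀ h1u]
    nlinarith
  have hCs : ((C * s : ℝ≥0) : ℝ) = C * s := NNReal.coe_mul _ _
  rcases le_or_gt ((C : ℝ) * s) s₀ with hA | hA
  · have hb := hSQ (C * s) (by rwa [hCs])
    rw [hCs, ENNReal.ofReal_le_iff_le_toReal hfin] at hb
    refine (hψ1.trans ?_).trans hb
    have h5 : √2 * e * x ≤ C * (s₁ * k) * x := by gcongr
    have h6 : (√2 * e * x) ^ 2 ≤ (C * (s₁ * k) * x) ^ 2 := by gcongr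
    calc 2 * e ^ 2 * x ^ 2 = (√2 * e * x) ^ 2 := by linear_combination -(e ^ 2 * x ^ 2) * hsq2
      _ ≤ (C * (s₁ * k) * x) ^ 2 := h6
      _ = κ * (C * s) ^ 2 := by rw [hsx, ← hkk]; ring
  rcases le_or_gt (C * s) s₁ with hB | hB
  · have hB' : (C : ℝ) * s ≤ s₁ := by exact_mod_cast hB
    have hCx : C * x ≤ 1 := by
      rw [hx, ← mul_div_assoc]; exact (div_le_one hs₁').2 hB'
    lift s₀ to ℝ≥0 using hs0.le
    have hb := div_mul_le_toReal_conj (α := α) (t := s₀) (r := C * s)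
      (v := κ * (s₀ : ℝ) ^ 2) hs0 (by rw [← NNReal.coe_le_coe, hCs]; exact hA.le) hfin
      (hSQ s₀ le_rfl)
    have hs0' : (s₀ : ℝ) ≠ 0 := hs0.ne'
    have e1 : ((C * s : ℝ≥0) : ℝ) / s₀ * (κ * (s₀ : ℝ) ^ 2) = (C * (s₁ * k)) * (s₀ * k) * x := by
      rw [hCs, hsx, ← hkk]; field_simp
    rw [e1] at hb
    refine (hψ1.trans ?_).trans hb
    -- One factor of the quadratic bound is at most u ≤ s₀√κ because Cs ≤ s₁; the other is covered
    -- by C s₁ √κ ≥ √2 e.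
    have h7 : √2 * e * x ≤ u := calc
      √2 * e * x ≤ C * u * x := mul_le_mul_of_nonneg_right hC1 hx0.le
      _ = u * (C * x) := by ring
      _ ≤ u * 1 := mul_le_mul_of_nonneg_left hCx hu0.le
      _ = u := mul_one u
    calc 2 * e ^ 2 * x ^ 2 = (√2 * e) * (√2 * e * x) * x := by
          linear_combination -(e ^ 2 * x ^ 2) * hsq2
      _ ≤ (C * (s₁ * k)) * (s₀ * k) * x := by
        have h8 := h7.trans hu3
        have h9 : 0 ≤ √2 * e * x := by positivity
        have h10 : 0 ≤ C * (s₁ * k) := by positivity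
        exact mul_le_mul_of_nonneg_right (mul_le_mul hC3 h8 h9 h10) hx0.le
  · have hb := two_mul_div_le_toReal_conj h₁ hs₁ hB hfin
    have e2 : 2 * ((C * s : ℝ≥0) : ℝ) / s₁ = 2 * C * x := by rw [hCs, hsx]; field_simp
    rw [e2] at hb
    refine le_trans ?_ hb
    have hCx : 7.6 * x ≤ 2 * C * x :=
      mul_le_mul_of_nonneg_right (by linarith) hx0.le
    refine le_trans ?_ hCx
    -- The quadratic bound is good enough up to x = 1/2 because e² ≤ 7.4; beyond that log 2 + 2x is.
    rcases le_total x 0.5 with hx5 | hx5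
    · have he2 : e ^ 2 ≤ 7.4 :=
        (pow_le_pow_left₀ (by linarith) he'.le 2).trans (by norm_num)
      have hxx : x ^ 2 ≤ 0.5 * x := by
        rw [sq]; exact mul_le_mul_of_nonneg_right hx5 hx0.le
      have := mul_le_mul he2 hxx (sq_nonneg x) (by norm_num)
      linarith
    · have := toReal_conj_le_div_mul (α := α) (v := 2) (by norm_num) hs₁ hle
        (by simpa using conj_le_of_le_genInv h₁.ge)
      rw [← hx] at this
      linarith

end Numerics

/-! ### Entropy duality and Laplace transforms of bounded centred functions. -/

section Entropy

variable {X : Type*} [MeasurableSpace X] {μ ν : Measure X} {α : ℝ≥0 → ℝ≥0∞}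

lemma integrable_of_bounded [IsFiniteMeasure μ] {f : X → ℝ} (hf : Measurable f) {M : ℝ}
    (hM : ∀ x, |f x| ≤ M) : Integrable f μ :=
  Integrable.of_bound hf.aestronglyMeasurable M (Filter.Eventually.of_forall hM)

lemma integrable_exp_of_bounded [IsFiniteMeasure μ] {f : X → ℝ} (hf : Measurable f) {M : ℝ}
    (hM : ∀ x, f x ≤ M) : Integrable (fun x => Real.exp (f x)) μ := by
  refine integrable_of_bounded (M := Real.exp M) hf.exp fun x => ?_
  rw [abs_of_pos (Real.exp_pos _)]
  exact Real.exp_le_exp.2 (hM x)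

/-- The easy half of the Donsker–Varadhan variational formula. -/
lemma integral_le_klDiv_add_log [IsProbabilityMeasure μ] [IsProbabilityMeasure ν]
    (hH : InformationTheory.klDiv ν μ ≠ ⊤) {f : X → ℝ} (hf : Measurable f) {M : ℝ}
    (hM : ∀ x, |f x| ≤ M) :
    ∫ x, f x ∂ν ≤ (InformationTheory.klDiv ν μ).toReal + Real.log (∫ x, Real.exp (f x) ∂μ) := by
  obtain ⟨hac, hint⟩ := InformationTheory.klDiv_ne_top_iff.1 hH
  have hfν : Integrable f ν := integrable_of_bounded hf hM
  have hfμ : Integrable (fun x => Real.exp (f x)) μ :=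
    integrable_exp_of_bounded hf fun x => (le_abs_self _).trans (hM x)
  have hprob : IsProbabilityMeasure (μ.tilted f) := isProbabilityMeasure_tilted hfμ
  -- The inequality is nonnegativity of the entropy of ν relative to the tilted measure e^f μ / ∫
  -- e^f dμ.
  have h1 := integral_llr_tilted_right hac hfν hfμ hint
  have h2 := InformationTheory.integral_llr_add_sub_measure_univ_nonneg
    (hac.trans (absolutelyContinuous_tilted hfμ)) (integrable_llr_tilted_right hac hfν hint hfμ)
  rw [InformationTheory.toReal_klDiv hac hint]
  simp only [probReal_univ] at h2 ⊢
  linarith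

/-- Jensen's inequality, by integrating the tangent line of exp at the mean. -/
lemma exp_integral_le [IsProbabilityMeasure μ] {f : X → ℝ} (hf : Measurable f) {M : ℝ}
    (hM : ∀ x, |f x| ≤ M) : Real.exp (∫ x, f x ∂μ) ≤ ∫ x, Real.exp (f x) ∂μ := by
  have hfμ : Integrable f μ := integrable_of_bounded hf hM
  set a := ∫ x, f x ∂μ with ha
  have hfa : Integrable (fun x => f x - a) μ := hfμ.sub (integrable_const _)
  have h1 : ∫ x, Real.exp a * (1 + (f x - a)) ∂μ ≤ ∫ x, Real.exp (f x) ∂μ := by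
    refine integral_mono (((integrable_const _).add hfa).const_mul _)
      (integrable_exp_of_bounded hf fun x => (le_abs_self _).trans (hM x)) fun x => ?_
    calc Real.exp a * (1 + (f x - a)) ≤ Real.exp a * Real.exp (f x - a) := by
          gcongr; linarith [Real.add_one_le_exp (f x - a)]
      _ = Real.exp (f x) := by rw [← Real.exp_add]; congr 1; ring
  rw [integral_const_mul, integral_add (integrable_const _) hfa,
    integral_sub hfμ (integrable_const _)] at h1
  simpa [← ha] using h1

lemma sq_integral_le [IsProbabilityMeasure μ] {f : X → ℝ} (hf : Measurable f) {M : ℝ}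
    (hM : ∀ x, |f x| ≤ M) : (∫ x, f x ∂μ) ^ 2 ≤ ∫ x, f x ^ 2 ∂μ := by
  have hfμ : Integrable f μ := integrable_of_bounded hf hM
  have hf2 : Integrable (fun x => f x ^ 2) μ := integrable_of_bounded (M := M ^ 2) (hf.pow_const 2)
    fun x => by rw [abs_pow]; gcongr; exact hM x
  set a := ∫ x, f x ∂μ with ha
  have h1 : 0 ≤ ∫ x, (f x ^ 2 - 2 * a * f x + a ^ 2) ∂μ :=
    integral_nonneg fun x => by
      have := sq_nonneg (f x - a)
      simp only [Pi.zero_apply]; linarith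
  have h2 : Integrable (fun x => f x ^ 2 - 2 * a * f x) μ := hf2.sub (hfμ.const_mul _)
  rw [integral_add h2 (integrable_const _),
    integral_sub hf2 (hfμ.const_mul _), integral_const_mul, ← ha] at h1
  simp at h1
  linarith

/-- Supplies the two hypotheses on ψ in `le_toReal_conj_mul`. For s ≤ s₁ expand e^{sg} with x =
s/s₁: the linear term integrates to 0 and the remainder to at most 2e²x², since α^⊛(s₁) ≤ 2. The
other bound is `hexp` at s. -/
lemma log_integral_exp_le [IsProbabilityMeasure μ] {s₀ κ u : ℝ} (hSQ : SuperQuadraticWith α s₀ κ)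
    (hu : AdmissibleParam s₀ κ u) {s₁ C s : ℝ≥0} (h₁ : genInv (conj α) 2 = s₁) (hs₁ : 0 < s₁)
    (hC1 : √2 * Real.exp 1 ≤ C * u) (hC2 : √2 * Real.exp 1 ≤ C * (s₁ * √(κ * (1 - u))))
    (hfin : conj α (C * s) ≠ ⊤) {g : X → ℝ} (hg : Measurable g) {M : ℝ} (hM : ∀ x, |g x| ≤ M)
    (hg0 : ∫ x, g x ∂μ = 0)
    (hexp : ∀ t : ℝ≥0, conj α t ≠ ⊤ →
      ∫ x, Real.exp (t * |g x|) ∂μ ≤ 2 * Real.exp (conj α t).toReal) :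
    Real.log (∫ x, Real.exp (s * g x) ∂μ) ≤ (conj α (C * s)).toReal := by
  have hs₁' : (0 : ℝ) < s₁ := hs₁
  have hgμ : Integrable g μ := integrable_of_bounded hg hM
  have hint1 (t : ℝ≥0) : Integrable (fun x => Real.exp (t * |g x|)) μ :=
    integrable_exp_of_bounded (M := t * M) (by fun_prop) fun x => by gcongr; exact hM x
  have hint2 : Integrable (fun x => Real.exp (s * g x)) μ :=
    integrable_exp_of_bounded (M := s * M) (by fun_prop) fun x => by
      gcongr; exact (le_abs_self _).trans (hM x)
  have hpos : 0 < ∫ x, Real.exp (s * g x) ∂μ := integral_exp_pos hint2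
  refine le_toReal_conj_mul hSQ hu h₁ hs₁ hC1 hC2 hfin (fun hle => ?_) ?_
  · set x : ℝ := (s : ℝ) / s₁ with hx
    have hx1 : x ≤ 1 := (div_le_one hs₁').2 hle
    have hsx : (s : ℝ) = x * s₁ := by rw [hx, div_mul_cancel₀ _ hs₁'.ne']
    have hc1 := conj_le_of_le_genInv h₁.ge
    have hc2 : (conj α s₁).toReal ≤ 2 := ENNReal.toReal_mono (by simp) hc1
    have h6 : Integrable (fun y => 1 + s * g y) μ := (integrable_const _).add (hgμ.const_mul _)
    have h2 : ∫ y, Real.exp (s * g y) ∂μ ≤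
        ∫ y, (1 + s * g y + x ^ 2 * Real.exp (s₁ * |g y|)) ∂μ := by
      refine integral_mono hint2 (h6.add ((hint1 s₁).const_mul _)) fun y => ?_
      have := exp_mul_le_of_le_one (x := x) (by positivity) hx1 (s₁ * g y)
      rw [abs_mul, abs_of_pos hs₁', ← mul_assoc, ← hsx] at this
      exact this
    rw [integral_add h6 ((hint1 s₁).const_mul _),
      integral_add (integrable_const _) (hgμ.const_mul _), integral_const_mul, integral_const_mul,
      hg0] at h2
    simp only [integral_const, probReal_univ, smul_eq_mul, mul_one, mul_zero,
      add_zero] at h2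
    have h3 := hexp s₁ (ne_top_of_le_ne_top (by simp) hc1)
    have h4 : Real.exp (conj α s₁).toReal ≤ Real.exp 1 ^ 2 := by
      rw [← Real.exp_nat_mul]
      exact Real.exp_le_exp.2 (by simpa using hc2)
    have h5 : x ^ 2 * ∫ y, Real.exp (s₁ * |g y|) ∂μ ≤ x ^ 2 * (2 * Real.exp 1 ^ 2) := by
      gcongr; linarith
    have := Real.log_le_sub_one_of_pos hpos
    linarith
  · have hfins : conj α s ≠ ⊤ := by
      refine ne_top_of_le_ne_top hfin (conj_mono α ?_)
      have : (1 : ℝ) ≤ C := by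
        have h6 : (1 : ℝ) ≤ √2 := Real.one_le_sqrt.2 (by norm_num)
        have h7 : (1 : ℝ) ≤ Real.exp 1 := Real.one_le_exp (by norm_num)
        have h8 : (C : ℝ) * u ≤ C * 1 := mul_le_mul_of_nonneg_left hu.2.1.le C.2
        nlinarith
      exact le_mul_of_one_le_left zero_le this
    have h2 : ∫ y, Real.exp (s * g y) ∂μ ≤ 2 * Real.exp (conj α s).toReal := by
      refine (integral_mono hint2 (hint1 s) fun y => ?_).trans (hexp s hfins)
      simp only
      gcongr
      exact le_abs_self _
    calc Real.log (∫ y, Real.exp (s * g y) ∂μ) ≤ Real.log (2 * Real.exp (conj α s).toReal) :=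
          Real.log_le_log hpos h2
      _ = Real.log 2 + (conj α s).toReal := by
        rw [Real.log_mul (by norm_num) (Real.exp_pos _).ne', Real.log_exp]

/-- Halving pays for centring: with Z = e^{t|f|/2}, the triangle inequality and Jensen bound the
left side by (∫ Z dμ)², which is at most ∫ Z² dμ. -/
lemma integral_exp_abs_center_le [IsProbabilityMeasure μ] {f : X → ℝ} (hf : Measurable f) {M : ℝ}
    (hM : ∀ x, |f x| ≤ M) (t : ℝ≥0) :
    ∫ x, Real.exp (t * |(f x - ∫ y, f y ∂μ) / 2|) ∂μ ≤ ∫ x, Real.exp (t * |f x|) ∂μ := by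
  set m := ∫ y, f y ∂μ with hm
  set Z : X → ℝ := fun x => Real.exp (t * |f x| / 2) with hZ
  have hfa : Measurable fun x => (t : ℝ) * |f x| / 2 := by fun_prop
  have hfb : ∀ x, |(t : ℝ) * |f x| / 2| ≤ t * M / 2 := fun x => by
    rw [abs_of_nonneg (by positivity)]
    gcongr; exact hM x
  have hZm : Measurable Z := hfa.exp
  have hZb : ∀ x, |Z x| ≤ Real.exp (t * M / 2) := fun x => by
    rw [abs_of_pos (Real.exp_pos _)]
    exact Real.exp_le_exp.2 ((le_abs_self _).trans (hfb x))
  have hZi : Integrable Z μ := integrable_of_bounded hZm hZb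
  have hm1 : Real.exp (t * |m| / 2) ≤ ∫ x, Z x ∂μ := by
    refine le_trans (Real.exp_le_exp.2 ?_) (exp_integral_le hfa hfb)
    rw [integral_div, integral_const_mul]
    gcongr
    exact abs_integral_le_integral_abs
  calc ∫ x, Real.exp (t * |(f x - m) / 2|) ∂μ ≤ ∫ x, Real.exp (t * |m| / 2) * Z x ∂μ := by
        refine integral_mono_of_nonneg (Filter.Eventually.of_forall fun x => (Real.exp_pos _).le)
          (hZi.const_mul _) (Filter.Eventually.of_forall fun x => ?_)
        simp only [hZ, ← Real.exp_add]
        refine Real.exp_le_exp.2 ?_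
        rw [abs_div, abs_two]
        have := mul_le_mul_of_nonneg_left (abs_sub (f x) m) t.2
        simp only [NNReal.val_eq_coe] at this
        linarith
    _ = Real.exp (t * |m| / 2) * ∫ x, Z x ∂μ := integral_const_mul _ _
    _ ≤ (∫ x, Z x ∂μ) ^ 2 := by
      rw [sq]
      gcongr
    _ ≤ ∫ x, Z x ^ 2 ∂μ := sq_integral_le hZm hZb
    _ = ∫ x, Real.exp (t * |f x|) ∂μ := by
      congr 1
      ext x
      simp only [hZ, ← Real.exp_nat_mul]
      congr 1
      push_cast
      ring

/-- Weighted Pinsker inequality, tested against a bounded function. -/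
lemma mul_integral_sub_integral_le [IsProbabilityMeasure μ] [IsProbabilityMeasure ν]
    (hH : InformationTheory.klDiv ν μ ≠ ⊤) {s₀ κ u : ℝ} (hSQ : SuperQuadraticWith α s₀ κ)
    (hu : AdmissibleParam s₀ κ u) {s₁ C s : ℝ≥0} (h₁ : genInv (conj α) 2 = s₁) (hs₁ : 0 < s₁)
    (hC1 : √2 * Real.exp 1 ≤ C * u) (hC2 : √2 * Real.exp 1 ≤ C * (s₁ * √(κ * (1 - u))))
    (hfin : conj α (C * s) ≠ ⊤) {f : X → ℝ} (hf : Measurable f) {M : ℝ} (hM : ∀ x, |f x| ≤ M)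
    (hexp : ∀ t : ℝ≥0, conj α t ≠ ⊤ →
      ∫ x, Real.exp (t * |f x|) ∂μ ≤ 2 * Real.exp (conj α t).toReal) :
    s * ((∫ x, f x ∂ν - ∫ x, f x ∂μ) / 2) ≤
      (InformationTheory.klDiv ν μ).toReal + (conj α (C * s)).toReal := by
  set m := ∫ x, f x ∂μ with hm
  have hfμ : Integrable f μ := integrable_of_bounded hf hM
  have hfν : Integrable f ν := integrable_of_bounded hf hM
  have hgm : Measurable fun x => (f x - m) / 2 := by fun_prop
  have hgM : ∀ x, |(f x - m) / 2| ≤ (M + |m|) / 2 := fun x => by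
    rw [abs_div, abs_two]
    have := abs_sub (f x) m
    linarith [hM x]
  have hg0 : ∫ x, (f x - m) / 2 ∂μ = 0 := by
    rw [integral_div, integral_sub hfμ (integrable_const _)]
    simp [← hm]
  have h1 := log_integral_exp_le hSQ hu h₁ hs₁ hC1 hC2 hfin hgm hgM hg0
    fun t ht => (integral_exp_abs_center_le hf hM t).trans (hexp t ht)
  have h2 := integral_le_klDiv_add_log hH (f := fun x => s * ((f x - m) / 2)) (by fun_prop)
    (M := s * ((M + |m|) / 2)) fun x => by
      rw [abs_mul, NNReal.abs_eq]
      exact mul_le_mul_of_nonneg_left (hgM x) s.2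
  rw [integral_const_mul, integral_div, integral_sub hfν (integrable_const _)] at h2
  simp only [integral_const, probReal_univ, smul_eq_mul, one_mul] at h2
  linarith

end Entropy

/-! ### Cost, weighted total variation and test functions. -/

section Coupling

variable {X : Type*} [MeasurableSpace X] {μ ν : Measure X} {α : ℝ≥0 → ℝ≥0∞}

/-- The density of the total variation measure `|ν - μ|` with respect to `μ`, if `ν ≪ μ`. -/
noncomputable def absDensity (ν μ : Measure X) (x : X) : ℝ≥0∞ :=
  (ν.rnDeriv μ x - 1) + (1 - ν.rnDeriv μ x)

/-- The cost is controlled by a weighted total variation distance: the common mass of `ν` and `μ`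
stays in place, and the rest is transported by a product coupling. -/
lemma optCost_le_mul_lintegral_absDensity [IsProbabilityMeasure μ] [IsProbabilityMeasure ν]
    (hac : ν ≪ μ) {c : X → X → ℝ≥0} (hc0 : ∀ x, c x x = 0) {χ : X → ℝ≥0} (hχ : Measurable χ)
    {A : ℝ≥0∞} (hA : ∀ x y, (c x y : ℝ≥0∞) ≤ A * (χ x + χ y)) :
    optCost c ν μ ≤ A * ∫⁻ x, χ x * absDensity ν μ x ∂μ := by
  set p := ν.rnDeriv μ with hp
  have hpm : Measurable p := Measure.measurable_rnDeriv ν μ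
  have hpν : μ.withDensity p = ν := Measure.withDensity_rnDeriv_eq ν μ hac
  have hχ' : Measurable fun x => (χ x : ℝ≥0∞) := hχ.coe_nnreal_ennreal
  set σ₀ := μ.withDensity (fun x => min (p x) 1) with hσ₀
  set σ₁ := μ.withDensity (fun x => p x - 1) with hσ₁
  set σ₂ := μ.withDensity (fun x => 1 - p x) with hσ₂
  have hm1 : Measurable fun x => p x - 1 := hpm.sub_const 1
  have hm2 : Measurable fun x => 1 - p x := hpm.const_sub 1
  have hm0 : Measurable fun x => min (p x) 1 := hpm.min measurable_const
  have h01 : σ₀ + σ₁ = ν := by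
    rw [hσ₀, hσ₁, ← withDensity_add_left hm0, ← hpν]
    congr 1
    ext x
    simp only [Pi.add_apply]
    rcases le_total (p x) 1 with h | h
    · rw [min_eq_left h, tsub_eq_zero_of_le h, add_zero]
    · rw [min_eq_right h, add_tsub_cancel_of_le h]
  have h02 : σ₀ + σ₂ = μ := by
    rw [hσ₀, hσ₂, ← withDensity_add_left hm0]
    conv_rhs => rw [← withDensity_one (μ := μ)]
    congr 1
    ext x
    simp only [Pi.add_apply, Pi.one_apply]
    rcases le_total (p x) 1 with h | h
    · rw [min_eq_left h, add_tsub_cancel_of_le h]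
    · rw [min_eq_right h, tsub_eq_zero_of_le h, add_zero]
  have hle1 : σ₁ ≤ ν := h01 ▸ Measure.le_add_left le_rfl
  have hle2 : σ₂ ≤ μ := h02 ▸ Measure.le_add_left le_rfl
  have hle0 : σ₀ ≤ μ := h02 ▸ Measure.le_add_right le_rfl
  have : IsFiniteMeasure σ₁ := isFiniteMeasure_of_le ν hle1
  have : IsFiniteMeasure σ₂ := isFiniteMeasure_of_le μ hle2
  have : IsFiniteMeasure σ₀ := isFiniteMeasure_of_le μ hle0
  have hmass : σ₁ Set.univ = σ₂ Set.univ := by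
    have e1 : σ₀ Set.univ + σ₁ Set.univ = 1 := by
      rw [← Measure.add_apply, h01, measure_univ]
    have e2 : σ₀ Set.univ + σ₂ Set.univ = 1 := by
      rw [← Measure.add_apply, h02, measure_univ]
    exact (ENNReal.add_right_inj (measure_ne_top σ₀ _)).1 (e1.trans e2.symm)
  set m := σ₁ Set.univ with hm
  have hmtop : m ≠ ⊤ := measure_ne_top σ₁ _
  -- The excess and the deficit have the same mass m. If m = 0, then m⁻¹ = ∞ multiplies the zero
  -- measure.
  set π₂ : Measure (X × X) := m⁻¹ • σ₁.prod σ₂ with hπ₂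
  have hfst : π₂.map Prod.fst = σ₁ := by
    rw [hπ₂, Measure.map_smul, Measure.map_fst_prod, ← hmass, smul_smul]
    rcases eq_or_ne m 0 with h0 | h0
    · have : σ₁ = 0 := Measure.measure_univ_eq_zero.1 h0
      simp [this]
    · rw [ENNReal.inv_mul_cancel h0 hmtop, one_smul]
  have hsnd : π₂.map Prod.snd = σ₂ := by
    rw [hπ₂, Measure.map_smul, Measure.map_snd_prod, smul_smul]
    rcases eq_or_ne m 0 with h0 | h0
    · have : σ₂ = 0 := Measure.measure_univ_eq_zero.1 (hmass ▸ h0)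
      simp [this]
    · rw [ENNReal.inv_mul_cancel h0 hmtop, one_smul]
  have hdiag : Measurable fun x : X => (x, x) := measurable_id.prodMk measurable_id
  set π₁ : Measure (X × X) := σ₀.map fun x => (x, x) with hπ₁
  have hfst' : (π₁ + π₂).fst = ν := by
    rw [Measure.fst, Measure.map_add _ _ measurable_fst, hfst, hπ₁,
      Measure.map_map measurable_fst hdiag]
    simpa [Function.comp_def] using h01
  have hsnd' : (π₁ + π₂).snd = μ := by
    rw [Measure.snd, Measure.map_add _ _ measurable_snd, hsnd, hπ₁,
      Measure.map_map measurable_snd hdiag]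
    simpa [Function.comp_def] using h02
  calc optCost c ν μ ≤ ∫⁻ z, (c z.1 z.2 : ℝ≥0∞) ∂(π₁ + π₂) :=
        iInf₂_le (π₁ + π₂) ⟨hfst', hsnd'⟩
    _ = ∫⁻ z, (c z.1 z.2 : ℝ≥0∞) ∂π₁ + ∫⁻ z, (c z.1 z.2 : ℝ≥0∞) ∂π₂ := lintegral_add_measure _ _ _
    _ ≤ ∫⁻ x, (c x x : ℝ≥0∞) ∂σ₀ + ∫⁻ z, A * (χ z.1 + χ z.2) ∂π₂ := by
      gcongr ?_ + ?_
      -- The cost is not assumed jointly measurable; this inequality holds without it.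
      · exact lintegral_map_le _ _
      · exact lintegral_mono fun z => hA _ _
    _ = A * (∫⁻ z, χ z.1 ∂π₂ + ∫⁻ z, χ z.2 ∂π₂) := by
      rw [lintegral_const_mul _ (by fun_prop), lintegral_add_left (by fun_prop)]
      simp [hc0]
    _ = A * (∫⁻ x, χ x ∂σ₁ + ∫⁻ x, χ x ∂σ₂) := by
      rw [← hfst, ← hsnd, lintegral_map hχ' measurable_fst, lintegral_map hχ' measurable_snd]
    _ = A * ∫⁻ x, χ x * absDensity ν μ x ∂μ := by
      rw [hσ₁, hσ₂, lintegral_withDensity_eq_lintegral_mul _ hm1 hχ',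
        lintegral_withDensity_eq_lintegral_mul _ hm2 hχ',
        ← lintegral_add_left (hm1.mul hχ')]
      congr 2
      ext x
      simp only [Pi.mul_apply, absDensity, ← hp]
      ring

lemma expOf_of_ne_top {r : ℝ≥0} (h : α r ≠ ⊤) :
    expOf α r = ENNReal.ofReal (Real.exp (α r).toReal) := by
  lift α r to ℝ≥0 using h with v hv
  rw [expOf, ← hv]
  rfl

lemma expOf_of_eq_top {r : ℝ≥0} (h : α r = ⊤) : expOf α r = ⊤ := by
  rw [expOf, h]; simp

lemma ofReal_exp_mul_le {t r : ℝ≥0} (ht : conj α t ≠ ⊤) :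
    ENNReal.ofReal (Real.exp (t * r)) ≤
      expOf α r * ENNReal.ofReal (Real.exp (conj α t).toReal) := by
  rcases eq_or_ne (α r) ⊤ with h | h
  · rw [expOf_of_eq_top h, ENNReal.top_mul (by simpa using Real.exp_pos _)]
    exact le_top
  · rw [expOf_of_ne_top h, ← ENNReal.ofReal_mul (Real.exp_pos _).le, ← Real.exp_add]
    refine ENNReal.ofReal_le_ofReal (Real.exp_le_exp.2 ?_)
    rw [← ENNReal.toReal_add h ht]
    have := ENNReal.toReal_mono (ENNReal.add_ne_top.2 ⟨h, ht⟩) (mul_le_add_conj α t r)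
    simpa using this

/-- Integrated Young inequality: the only way in which the Orlicz condition enters the Pinsker
bound. -/
lemma integral_exp_mul_abs_le [IsFiniteMeasure μ] {χ : X → ℝ≥0}
    (hexp : ∫⁻ x, expOf α (χ x) ∂μ ≤ 2) {f : X → ℝ} (hf : Measurable f)
    (hfχ : ∀ x, |f x| ≤ χ x) (t : ℝ≥0) (ht : conj α t ≠ ⊤) :
    ∫ x, Real.exp (t * |f x|) ∂μ ≤ 2 * Real.exp (conj α t).toReal := by
  have hm : Measurable fun x => Real.exp (t * |f x|) := by fun_prop
  rw [integral_eq_lintegral_of_nonneg_ae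
    (Filter.Eventually.of_forall fun x => (Real.exp_pos _).le) hm.aestronglyMeasurable]
  refine ENNReal.toReal_le_of_le_ofReal (by positivity) ?_
  calc ∫⁻ x, ENNReal.ofReal (Real.exp (t * |f x|)) ∂μ
      ≤ ∫⁻ x, expOf α (χ x) * ENNReal.ofReal (Real.exp (conj α t).toReal) ∂μ := by
        refine lintegral_mono fun x => le_trans ?_ (ofReal_exp_mul_le ht)
        refine ENNReal.ofReal_le_ofReal (Real.exp_le_exp.2 ?_)
        gcongr
        exact_mod_cast hfχ x
    _ = (∫⁻ x, expOf α (χ x) ∂μ) * ENNReal.ofReal (Real.exp (conj α t).toReal) :=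
      lintegral_mul_const' _ _ ENNReal.ofReal_ne_top
    _ ≤ 2 * ENNReal.ofReal (Real.exp (conj α t).toReal) := by gcongr
    _ = ENNReal.ofReal (2 * Real.exp (conj α t).toReal) := by
      rw [ENNReal.ofReal_mul (by norm_num)]; simp

/-- A bounded function realizing the weighted total variation distance. -/
lemma exists_integral_sub_eq [IsProbabilityMeasure μ] [IsProbabilityMeasure ν]
    (hac : ν ≪ μ) {h : X → ℝ≥0} (hh : Measurable h) {M : ℝ≥0} (hM : ∀ x, h x ≤ M) :
    ∃ f : X → ℝ, Measurable f ∧ (∀ x, |f x| ≤ h x) ∧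
      ENNReal.ofReal (∫ x, f x ∂ν - ∫ x, f x ∂μ) = ∫⁻ x, h x * absDensity ν μ x ∂μ := by
  set p := ν.rnDeriv μ with hp
  have hpm : Measurable p := Measure.measurable_rnDeriv ν μ
  have hS : MeasurableSet {x | 1 ≤ p x} := measurableSet_le measurable_const hpm
  classical
  -- h times the sign of dν/dμ - 1.
  let f : X → ℝ := fun x => if 1 ≤ p x then (h x : ℝ) else -(h x : ℝ)
  have hfm : Measurable f := Measurable.ite hS hh.coe_nnreal_real hh.coe_nnreal_real.neg
  have hfh : ∀ x, |f x| ≤ h x := fun x => by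
    simp only [f]
    split_ifs <;> simp
  have hfM : ∀ x, |f x| ≤ M := fun x => (hfh x).trans (by exact_mod_cast hM x)
  have hfμ : Integrable f μ := integrable_of_bounded hfm hfM
  have hfν : Integrable f ν := integrable_of_bounded hfm hfM
  refine ⟨f, hfm, hfh, ?_⟩
  have hpi : Integrable (fun x => (p x).toReal • f x) μ :=
    (integrable_rnDeriv_smul_iff hac).2 hfν
  have e1 : ∫ x, f x ∂ν - ∫ x, f x ∂μ = ∫ x, ((p x).toReal • f x - f x) ∂μ := by
    rw [integral_sub hpi hfμ, integral_rnDeriv_smul hac]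
  have hnn : ∀ x, p x ≠ ⊤ → ENNReal.ofReal ((p x).toReal • f x - f x) = h x * absDensity ν μ x ∧
      0 ≤ (p x).toReal • f x - f x := by
    intro x hx
    simp only [absDensity, ← hp, f]
    generalize hv : p x = v at hx
    lift v to ℝ≥0 using hx
    have hone : (1 : ℝ≥0∞) = ((1 : ℝ≥0) : ℝ≥0∞) := rfl
    rcases le_total 1 v with h1 | h1
    · have h1' : (1 : ℝ≥0∞) ≤ v := by exact_mod_cast h1
      have e : (v : ℝ) * (h x : ℝ) - h x = ((h x * (v - 1) : ℝ≥0) : ℝ) := by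
        push_cast [NNReal.coe_sub h1]; ring
      simp only [h1', if_true, ENNReal.coe_toReal, smul_eq_mul, tsub_eq_zero_of_le, add_zero]
      rw [e]
      refine ⟨?_, NNReal.coe_nonneg _⟩
      rw [ENNReal.ofReal_coe_nnreal, hone, ← ENNReal.coe_sub, ← ENNReal.coe_mul]
    · have h1' : (v : ℝ≥0∞) ≤ 1 := by exact_mod_cast h1
      have e : (v : ℝ) * (if (1 : ℝ≥0∞) ≤ v then (h x : ℝ) else -(h x : ℝ)) -
          (if (1 : ℝ≥0∞) ≤ v then (h x : ℝ) else -(h x : ℝ)) = ((h x * (1 - v) : ℝ≥0) : ℝ) := by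
        push_cast [NNReal.coe_sub h1]
        split_ifs with h2
        · have : v = 1 := le_antisymm h1 (by exact_mod_cast h2)
          simp [this]
        · ring
      simp only [ENNReal.coe_toReal, smul_eq_mul, tsub_eq_zero_of_le h1', zero_add]
      rw [e]
      refine ⟨?_, NNReal.coe_nonneg _⟩
      rw [ENNReal.ofReal_coe_nnreal, hone, ← ENNReal.coe_sub, ← ENNReal.coe_mul]
  have hae : ∀ᵐ x ∂μ, p x ≠ ⊤ := by
    filter_upwards [Measure.rnDeriv_lt_top ν μ] with x hx using hx.ne
  have hsub : Integrable (fun x => (p x).toReal • f x - f x) μ := hpi.sub hfμ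
  rw [e1, ofReal_integral_eq_lintegral_ofReal hsub
    (hae.mono fun x hx => (hnn x hx).2)]
  exact lintegral_congr_ae (hae.mono fun x hx => (hnn x hx).1)

end Coupling

/-! ### From weighted Pinsker to the transport inequality. -/

section UpperBound

variable {X : Type*} [MeasurableSpace X] {μ ν : Measure X} {α : ℝ≥0 → ℝ≥0∞}

lemma mConst_eq_ofReal {κ u : ℝ} {s₁ : ℝ≥0} (h₁ : genInv (conj α) 2 = s₁) (hs₁ : 0 < s₁)
    (hκ : 0 < κ) (hu0 : 0 < u) (hu1 : u < 1) :
    mConst α κ u =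
      ENNReal.ofReal (Real.exp 1 * max (1 / (s₁ * √(κ * (1 - u)))) (1 / u)) := by
  have h2 : 0 < √(κ * (1 - u)) := Real.sqrt_pos.2 (mul_pos hκ (by linarith))
  have hs₁' : (0 : ℝ) < s₁ := hs₁
  rw [mConst, h₁, ENNReal.ofReal_mul (Real.exp_pos _).le, ENNReal.ofReal_max,
    ENNReal.ofReal_div_of_pos hu0, ENNReal.ofReal_div_of_pos (by positivity),
    ENNReal.ofReal_mul hs₁'.le, ENNReal.ofReal_coe_nnreal, ENNReal.ofReal_one]

/-- C = √2 m_α; the two lower bounds on C are the two entries of the maximum in m_α. -/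
lemma exists_eq_sqrt_two_mul_mConst (hA1 : AssumptionA1 α) {s₀ κ u : ℝ}
    (hSQ : SuperQuadraticWith α s₀ κ) (hu : AdmissibleParam s₀ κ u) :
    ∃ s₁ C : ℝ≥0, genInv (conj α) 2 = s₁ ∧ 0 < s₁ ∧ 0 < C ∧
      (C : ℝ≥0∞) = ENNReal.ofReal √2 * mConst α κ u ∧
      √2 * Real.exp 1 ≤ C * u ∧ √2 * Real.exp 1 ≤ C * (s₁ * √(κ * (1 - u))) := by
  obtain ⟨s₁, h₁⟩ := WithTop.ne_top_iff_exists.1 (genInv_conj_ne_top hSQ)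
  have hs₁ : 0 < s₁ := by
    rw [pos_iff_ne_zero]
    rintro rfl
    exact genInv_conj_ne_zero hA1 h₁.symm
  obtain ⟨hu0, hu1, -⟩ := hu
  have h2 : 0 < √(κ * (1 - u)) := Real.sqrt_pos.2 (mul_pos hSQ.2.1 (by linarith))
  have hs₁' : (0 : ℝ) < s₁ := hs₁
  have h3 : 0 < (s₁ : ℝ) * √(κ * (1 - u)) := by positivity
  set m := max (1 / (s₁ * √(κ * (1 - u)))) (1 / u)
  have hm : 0 < m := lt_of_lt_of_le (by positivity) (le_max_right _ _)
  have hC : 0 < √2 * (Real.exp 1 * m) := by positivity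
  refine ⟨s₁, ⟨√2 * (Real.exp 1 * m), hC.le⟩, h₁.symm, hs₁, hC, ?_, ?_, ?_⟩
  · rw [mConst_eq_ofReal h₁.symm hs₁ hSQ.2.1 hu0 hu1, ← ENNReal.ofReal_mul (Real.sqrt_nonneg _),
      ENNReal.ofReal_eq_coe_nnreal hC.le]
    rfl
  · have : 1 ≤ m * u := by
      rw [← div_le_iff₀ hu0]; exact le_max_right _ _
    calc √2 * Real.exp 1 = √2 * Real.exp 1 * 1 := (mul_one _).symm
      _ ≤ √2 * Real.exp 1 * (m * u) := by gcongr
      _ = √2 * (Real.exp 1 * m) * u := by ring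
  · have : 1 ≤ m * (s₁ * √(κ * (1 - u))) := by
      rw [← div_le_iff₀ h3]; exact le_max_left _ _
    calc √2 * Real.exp 1 = √2 * Real.exp 1 * 1 := (mul_one _).symm
      _ ≤ √2 * Real.exp 1 * (m * (s₁ * √(κ * (1 - u)))) := by gcongr
      _ = √2 * (Real.exp 1 * m) * (s₁ * √(κ * (1 - u))) := by ring

/-- Weighted Pinsker inequality in its dual form. -/
lemma mul_lintegral_absDensity_le [IsProbabilityMeasure μ] [IsProbabilityMeasure ν]
    (hH : InformationTheory.klDiv ν μ ≠ ⊤) {s₀ κ u : ℝ} (hSQ : SuperQuadraticWith α s₀ κ)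
    (hu : AdmissibleParam s₀ κ u) {s₁ C s : ℝ≥0} (h₁ : genInv (conj α) 2 = s₁) (hs₁ : 0 < s₁)
    (hC1 : √2 * Real.exp 1 ≤ C * u) (hC2 : √2 * Real.exp 1 ≤ C * (s₁ * √(κ * (1 - u))))
    (hfin : conj α (C * s) ≠ ⊤) {χ : X → ℝ≥0} (hχ : Measurable χ)
    (hexp : ∫⁻ x, expOf α (χ x) ∂μ ≤ 2) :
    s * ((∫⁻ x, χ x * absDensity ν μ x ∂μ) / 2) ≤
      InformationTheory.klDiv ν μ + conj α (C * s) := by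
  have hac := (InformationTheory.klDiv_ne_top_iff.1 hH).1
  -- Truncation yields bounded test functions still dominated by χ; monotone convergence removes it.
  have hn (n : ℕ) : s * ((∫⁻ x, (min (χ x) n : ℝ≥0) * absDensity ν μ x ∂μ) / 2) ≤
      InformationTheory.klDiv ν μ + conj α (C * s) := by
    obtain ⟨f, hfm, hfh, hf⟩ := exists_integral_sub_eq hac (h := fun x => min (χ x) n)
      (hχ.min measurable_const) (M := n) fun x => min_le_right _ _
    have hfM : ∀ x, |f x| ≤ ((n : ℝ≥0) : ℝ) := fun x =>
      (hfh x).trans (NNReal.coe_le_coe.2 (min_le_right _ _))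
    have h := mul_integral_sub_integral_le hH hSQ hu h₁ hs₁ hC1 hC2 hfin hfm hfM
      (integral_exp_mul_abs_le hexp hfm fun x =>
        (hfh x).trans (NNReal.coe_le_coe.2 (min_le_left _ _)))
    rw [← hf, ← ENNReal.ofReal_toReal hH, ← ENNReal.ofReal_toReal hfin,
      ← ENNReal.ofReal_add ENNReal.toReal_nonneg ENNReal.toReal_nonneg,
      ← ENNReal.ofReal_coe_nnreal (p := s)]
    have h2 : (2 : ℝ≥0∞) = ENNReal.ofReal 2 := by simp
    rw [h2, ← ENNReal.ofReal_div_of_pos (by norm_num), ← ENNReal.ofReal_mul s.coe_nonneg]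
    exact ENNReal.ofReal_le_ofReal h
  have hDm : Measurable (absDensity ν μ) :=
    ((Measure.measurable_rnDeriv ν μ).sub_const 1).add
      ((Measure.measurable_rnDeriv ν μ).const_sub 1)
  have hsup : ∫⁻ x, χ x * absDensity ν μ x ∂μ =
      ⨆ n : ℕ, ∫⁻ x, (min (χ x) n : ℝ≥0) * absDensity ν μ x ∂μ := by
    rw [← lintegral_iSup]
    · congr 1
      ext x
      rw [← ENNReal.iSup_mul]
      congr 1
      refine le_antisymm ?_ (iSup_le fun n => by exact_mod_cast min_le_left _ _)
      obtain ⟨n, hn⟩ := exists_nat_ge (χ x)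
      refine le_iSup_of_le n ?_
      rw [min_eq_left hn]
    · intro n
      exact (hχ.min measurable_const).coe_nnreal_ennreal.mul hDm
    · intro n k hnk x
      simp only
      gcongr
  rw [hsup, ENNReal.div_eq_inv_mul, ENNReal.mul_iSup, ENNReal.mul_iSup]
  refine iSup_le fun n => ?_
  rw [← ENNReal.div_eq_inv_mul]
  exact hn n

/-- The transport inequality with an admissible constant `L` of the Luxemburg norm. -/
lemma le_klDiv_of_mul_le_optCost [IsProbabilityMeasure μ] [IsProbabilityMeasure ν]
    (hα : ConvexClass α) (hA1 : AssumptionA1 α) {s₀ κ u : ℝ} (hSQ : SuperQuadraticWith α s₀ κ)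
    (hu : AdmissibleParam s₀ κ u) {c : X → X → ℝ≥0} (hc0 : ∀ x, c x x = 0) {χ : X → ℝ≥0}
    (hχ : Measurable χ) {K : ℝ} (hK : 0 < K)
    (hcχ : ∀ x y, (c x y : ℝ≥0∞) ≤ ENNReal.ofReal (K / 2) * (χ x + χ y))
    {L : ℝ≥0} (hL : 0 < L) (hexp : ∫⁻ x, expOf α (χ x / L) ∂μ ≤ 2) {ρ : ℝ≥0}
    (hρ : ρ * (ENNReal.ofReal (√2 * K) * mConst α κ u * L) ≤ optCost c ν μ) :
    α ρ ≤ InformationTheory.klDiv ν μ := by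
  rcases eq_or_ne (InformationTheory.klDiv ν μ) ⊤ with hH | hH
  · rw [hH]; exact le_top
  obtain ⟨s₁, C, h₁, hs₁, hC0, hC, hC1, hC2⟩ := exists_eq_sqrt_two_mul_mConst hA1 hSQ hu
  have hac := (InformationTheory.klDiv_ne_top_iff.1 hH).1
  have hL' : (L : ℝ≥0∞) ≠ 0 := by simpa using hL.ne'
  have hχL : Measurable fun x => χ x / L := hχ.div_const L
  set V := ∫⁻ x, (χ x / L : ℝ≥0) * absDensity ν μ x ∂μ with hV
  have hT : optCost c ν μ ≤ ENNReal.ofReal (K / 2) * L * V := by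
    refine optCost_le_mul_lintegral_absDensity hac hc0 hχL fun x y => (hcχ x y).trans ?_
    rw [mul_assoc]
    gcongr
    rw [← ENNReal.coe_add, ← ENNReal.coe_add, ← ENNReal.coe_mul, ENNReal.coe_le_coe, mul_add,
      mul_div_cancel₀ _ hL.ne', mul_div_cancel₀ _ hL.ne']
  have hCρ : ((C * ρ : ℝ≥0) : ℝ≥0∞) ≤ V / 2 := by
    have hKL0 : ENNReal.ofReal K * L ≠ 0 := mul_ne_zero (by simpa using hK) hL'
    have hKLt : ENNReal.ofReal K * L ≠ ⊤ :=
      ENNReal.mul_ne_top ENNReal.ofReal_ne_top ENNReal.coe_ne_top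
    rw [← ENNReal.mul_le_mul_iff_right hKL0 hKLt]
    calc ENNReal.ofReal K * L * ((C * ρ : ℝ≥0) : ℝ≥0∞)
        = ρ * (ENNReal.ofReal (√2 * K) * mConst α κ u * L) := by
          rw [ENNReal.coe_mul, hC, ENNReal.ofReal_mul (Real.sqrt_nonneg _)]; ring
      _ ≤ ENNReal.ofReal (K / 2) * L * V := hρ.trans hT
      _ = ENNReal.ofReal K * L * (V / 2) := by
        rw [ENNReal.ofReal_div_of_pos (by norm_num)]
        simp only [ENNReal.ofReal_ofNat, div_eq_mul_inv]
        ring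
  -- The Pinsker bound at s/C has α^⊛(s) on the right.
  refine hα.le_of_forall_conj fun s => ?_
  rcases eq_or_ne (conj α s) ⊤ with hs | hs
  · simp [hs]
  have hsC : C * (s / C) = s := mul_div_cancel₀ _ hC0.ne'
  have h := mul_lintegral_absDensity_le hH hSQ hu (s := s / C) h₁ hs₁ hC1 hC2 (by rwa [hsC]) hχL
    hexp
  rw [hsC] at h
  refine le_trans ?_ h
  calc ((s * ρ : ℝ≥0) : ℝ≥0∞) = ((s / C : ℝ≥0) : ℝ≥0∞) * ((C * ρ : ℝ≥0) : ℝ≥0∞) := by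
        rw [← ENNReal.coe_mul, ← mul_assoc, div_mul_cancel₀ _ hC0.ne']
    _ ≤ _ := by gcongr

lemma ConvexClass.le_of_forall_lt (hα : ConvexClass α) {r : ℝ≥0} {H : ℝ≥0∞}
    (h : ∀ ρ < r, α ρ ≤ H) : α r ≤ H := by
  rcases eq_or_ne r 0 with rfl | hr
  · simp [hα.map_zero]
  by_contra! hlt
  have h2 : ∀ᶠ t in nhdsWithin r (Set.Iio r), H < α t :=
    nhdsWithin_le_nhds (hα.lowerSemicontinuous r H hlt)
  have : (nhdsWithin r (Set.Iio r)).NeBot :=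
    nhdsWithin_Iio_neBot' ⟨0, pos_iff_ne_zero.2 hr⟩ le_rfl
  obtain ⟨y, hy, hy'⟩ := (h2.and self_mem_nhdsWithin).exists
  exact absurd hy (not_lt.2 (h y hy'))

/-- Approaching T/a from below treats a = 0 and infinite quotients uniformly. The strict inequality
also leaves room to replace an infimum in a by an admissible constant. -/
lemma ConvexClass.extend_div_le (hα : ConvexClass α) {T a H : ℝ≥0∞}
    (h : ∀ ρ : ℝ≥0, ρ * a < T → α ρ ≤ H) : extend α (T / a) ≤ H := by
  rw [extend]
  split_ifs with htop
  · exact iSup_le fun ρ => h ρ (ENNReal.mul_lt_of_lt_div (by rw [htop]; exact ENNReal.coe_lt_top))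
  · refine hα.le_of_forall_lt fun ρ hρ => h ρ (ENNReal.mul_lt_of_lt_div ?_)
    rw [← ENNReal.coe_toNNReal htop]
    exact_mod_cast hρ

lemma ConvexClass.extend_mono (hα : ConvexClass α) : Monotone (extend α) := by
  intro x y hxy
  rw [extend, extend]
  split_ifs with hx hy hy
  · exact le_rfl
  · exact absurd (top_le_iff.1 (hx ▸ hxy)) hy
  · exact le_iSup α _
  · exact hα.monotone (ENNReal.toNNReal_mono hy hxy)

lemma one_le_expOf (α : ℝ≥0 → ℝ≥0∞) (t : ℝ≥0) : 1 ≤ expOf α t := by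
  rw [expOf, EReal.one_le_exp_iff]
  exact EReal.coe_ennreal_nonneg _

lemma lintegral_expOf_eq [IsProbabilityMeasure μ] (f : X → ℝ≥0) :
    ∫⁻ x, expOf α (f x) ∂μ = ∫⁻ x, tau α (f x) ∂μ + 1 := by
  calc ∫⁻ x, expOf α (f x) ∂μ = ∫⁻ x, (tau α (f x) + 1) ∂μ :=
        lintegral_congr fun x => (tsub_add_cancel_of_le (one_le_expOf α _)).symm
    _ = ∫⁻ x, tau α (f x) ∂μ + 1 := by
      rw [lintegral_add_right _ measurable_const]; simp

lemma lintegral_tau_le_one_iff [IsProbabilityMeasure μ] (f : X → ℝ≥0) :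
    ∫⁻ x, tau α (f x) ∂μ ≤ 1 ↔ ∫⁻ x, expOf α (f x) ∂μ ≤ 2 := by
  rw [lintegral_expOf_eq, ← one_add_one_eq_two, ENNReal.add_le_add_iff_right ENNReal.one_ne_top]

/-- Convexity of exp applied to θ(α t - b). With b = log A and A the integral of the exponential,
integrating gives A^θ: Jensen for a concave power, in a form that needs no measurability. -/
lemma ConvexClass.expOf_mul_le (hα : ConvexClass α) {θ : ℝ≥0} (hθ0 : 0 < θ) (hθ : θ ≤ 1) (b : ℝ)
    (t : ℝ≥0) : expOf α (θ * t) ≤ ENNReal.ofReal (Real.exp (θ * b) * (1 - θ)) +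
      ENNReal.ofReal (Real.exp (θ * b) * θ * Real.exp (-b)) * expOf α t := by
  have hθ' : (0 : ℝ) < θ := hθ0
  have hθ1 : (θ : ℝ) ≤ 1 := hθ
  rcases eq_or_ne (α t) ⊤ with ht | ht
  · rw [expOf_of_eq_top ht, ENNReal.mul_top]
    · simp
    · rw [Ne, ENNReal.ofReal_eq_zero, not_le]; positivity
  have h1 := hα.map_mul_le hθ t
  have hne : (θ : ℝ≥0∞) * α t ≠ ⊤ := ENNReal.mul_ne_top ENNReal.coe_ne_top ht
  rw [expOf_of_ne_top ht, expOf_of_ne_top (ne_top_of_le_ne_top hne h1),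
    ← ENNReal.ofReal_mul (by positivity),
    ← ENNReal.ofReal_add (mul_nonneg (Real.exp_pos _).le (by linarith)) (by positivity)]
  refine ENNReal.ofReal_le_ofReal ?_
  set a := (α t).toReal
  have h2 : (α (θ * t)).toReal ≤ θ * a := by
    simpa using ENNReal.toReal_mono hne h1
  have h3 : Real.exp (θ * (a - b)) ≤ (1 - θ) + θ * Real.exp (a - b) := by
    have := convexOn_exp.2 (Set.mem_univ (0 : ℝ)) (Set.mem_univ (a - b)) (sub_nonneg.2 hθ1) hθ'.le
      (by ring)
    simpa using this
  calc Real.exp (α (θ * t)).toReal ≤ Real.exp (θ * b) * Real.exp (θ * (a - b)) := by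
        rw [← Real.exp_add]
        refine Real.exp_le_exp.2 (h2.trans_eq ?_)
        ring
    _ ≤ Real.exp (θ * b) * ((1 - θ) + θ * Real.exp (a - b)) := by gcongr
    _ = _ := by
      rw [sub_eq_add_neg a b, Real.exp_add]; ring

lemma exists_eq_expBound [IsProbabilityMeasure μ] (hα : ConvexClass α) {χ : X → ℝ≥0} {δ : ℝ≥0}
    (hδ : 0 < δ) (hfin : ∫⁻ x, expOf α (δ * χ x) ∂μ ≠ ⊤) :
    ∃ l : ℝ≥0, 0 < l ∧ (l : ℝ≥0∞) = expBound α μ χ δ ∧ ∫⁻ x, expOf α (χ x / l) ∂μ ≤ 2 := by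
  set A := ∫⁻ x, expOf α (δ * χ x) ∂μ with hA
  have hA1 : 1 ≤ A := by
    calc (1 : ℝ≥0∞) = ∫⁻ _, 1 ∂μ := by simp
      _ ≤ A := lintegral_mono fun x => one_le_expOf α _
  have hAr : 1 ≤ A.toReal := by simpa using ENNReal.toReal_mono hfin hA1
  set b := Real.log A.toReal with hb
  have hb0 : 0 ≤ b := Real.log_nonneg hAr
  have hbA : A = ENNReal.ofReal (Real.exp b) := by
    rw [hb, Real.exp_log (by linarith), ENNReal.ofReal_toReal hfin]
  have hl2 : 0 < Real.log 2 := Real.log_pos (by norm_num)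
  -- Chosen so that 1/w = 1 + log A / log 2 and A^w ≤ 2. The summand log 2 in the denominator keeps
  -- w in ]0, 1], also when A = 1.
  set w : ℝ := Real.log 2 / (Real.log 2 + b) with hw
  have hw0 : 0 < w := by positivity
  have hw1 : w ≤ 1 := (div_le_one (by positivity)).2 (by linarith)
  have hwb : w * b ≤ Real.log 2 := by
    rw [hw, div_mul_eq_mul_div, div_le_iff₀ (by positivity)]
    nlinarith [mul_pos hl2 hl2]
  set θ : ℝ≥0 := ⟨w, hw0.le⟩ with hθ
  have hθ0 : 0 < θ := hw0
  have hlogA : (ENNReal.log A).toENNReal = ENNReal.ofReal b := by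
    rw [hbA]
    have : ENNReal.ofReal (Real.exp b) = EReal.exp b := (EReal.exp_coe b).symm
    rw [this, EReal.log_exp]
    simp
  refine ⟨1 / (θ * δ), by positivity, ?_, ?_⟩
  · rw [expBound, ← hA, hlogA, ← ENNReal.ofReal_div_of_pos hl2, ← ENNReal.ofReal_one,
      ← ENNReal.ofReal_add zero_le_one (by positivity)]
    have e : 1 + b / Real.log 2 = ((1 / θ : ℝ≥0) : ℝ) := by
      change _ = 1 / w
      rw [hw]
      field_simp
    rw [e, ENNReal.ofReal_coe_nnreal, ENNReal.ofReal_one, ← ENNReal.coe_one,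
      ← ENNReal.coe_div hδ.ne', ← ENNReal.coe_mul]
    congr 1
    field_simp
  · calc ∫⁻ x, expOf α (χ x / (1 / (θ * δ))) ∂μ
        ≤ ∫⁻ x, (ENNReal.ofReal (Real.exp (θ * b) * (1 - θ)) +
          ENNReal.ofReal (Real.exp (θ * b) * θ * Real.exp (-b)) * expOf α (δ * χ x)) ∂μ := by
          refine lintegral_mono fun x => ?_
          have e : χ x / (1 / (θ * δ)) = θ * (δ * χ x) := by field_simp
          simp only [e]
          exact hα.expOf_mul_le hθ0 hw1 b _
      _ = ENNReal.ofReal (Real.exp (θ * b) * (1 - θ)) +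
          ENNReal.ofReal (Real.exp (θ * b) * θ * Real.exp (-b)) * A := by
        rw [lintegral_add_left measurable_const, lintegral_const_mul' _ _ ENNReal.ofReal_ne_top]
        simp [hA]
      _ = ENNReal.ofReal (Real.exp (w * b)) := by
        have hc : (θ : ℝ) = w := rfl
        rw [hbA, hc, ← ENNReal.ofReal_mul (by positivity),
          ← ENNReal.ofReal_add (mul_nonneg (Real.exp_pos _).le (by linarith)) (by positivity)]
        congr 1
        rw [mul_assoc, ← Real.exp_add]
        simp
        ring
      _ ≤ 2 := by
        refine ENNReal.ofReal_le_of_le_toReal ?_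
        refine (Real.exp_le_exp.2 hwb).trans ?_
        rw [Real.exp_log (by norm_num)]; simp

end UpperBound

/-! ### From the transport inequality to exponential integrability. -/

section Necessity

variable {X : Type*} [MeasurableSpace X] {μ ν : Measure X} {α : ℝ≥0 → ℝ≥0∞}

lemma klDiv_cond_le [IsProbabilityMeasure μ] {S : Set X} (hS : MeasurableSet S) (hμS : μ S ≠ 0) :
    InformationTheory.klDiv (ProbabilityTheory.cond μ S) μ ≤
      ENNReal.ofReal (-Real.log (μ S).toReal) := by
  have hprob : IsProbabilityMeasure (ProbabilityTheory.cond μ S) :=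
    ProbabilityTheory.cond_isProbabilityMeasure hμS
  have hac : ProbabilityTheory.cond μ S ≪ μ := ProbabilityTheory.cond_absolutelyContinuous
  have hinv : (μ S)⁻¹ ≠ ⊤ := ENNReal.inv_ne_top.2 hμS
  have h1 : (ProbabilityTheory.cond μ S).rnDeriv μ =ᵐ[μ] fun x => (μ S)⁻¹ * S.indicator 1 x := by
    have e1 := Measure.rnDeriv_smul_left_of_ne_top (μ.restrict S) μ hinv
    filter_upwards [e1, Measure.rnDeriv_restrict_self μ hS] with x hx1 hx2
    rw [ProbabilityTheory.cond, hx1, Pi.smul_apply, hx2, smul_eq_mul]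
  have hmem : ∀ᵐ x ∂(ProbabilityTheory.cond μ S), x ∈ S := ProbabilityTheory.ae_cond_mem hS
  have h2 : llr (ProbabilityTheory.cond μ S) μ =ᵐ[ProbabilityTheory.cond μ S]
      fun _ => -Real.log (μ S).toReal := by
    filter_upwards [hac.ae_le h1, hmem] with x hx hxS
    rw [llr, hx, Set.indicator_of_mem hxS]
    simp [Real.log_inv]
  rw [InformationTheory.klDiv_of_ac_of_integrable hac
    ((integrable_const _).congr h2.symm), integral_congr_ae h2]
  simp

lemma lintegral_cond [IsFiniteMeasure μ] (S : Set X) (f : X → ℝ≥0∞) :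
    ∫⁻ x, f x ∂(ProbabilityTheory.cond μ S) = ⨍⁻ x in S, f x ∂μ := by
  rw [ProbabilityTheory.cond, lintegral_smul_measure, setLAverage_eq, ENNReal.div_eq_inv_mul,
    smul_eq_mul]

/-- The easy half of Kantorovich duality: integrate `hcχ` against any coupling. -/
lemma mul_lintegral_sub_le_optCost {c : X → X → ℝ≥0} {χ : X → ℝ≥0} (hχ : Measurable χ)
    {k : ℝ≥0} (hcχ : ∀ x y, k * χ x ≤ c x y + χ y) :
    k * ∫⁻ x, χ x ∂ν - ∫⁻ x, χ x ∂μ ≤ optCost c ν μ := by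
  refine le_iInf₂ fun π hπ => ?_
  rw [tsub_le_iff_right]
  have hχ' : Measurable fun x => (χ x : ℝ≥0∞) := hχ.coe_nnreal_ennreal
  obtain ⟨h1, h2⟩ := hπ
  have hχ2 : Measurable fun z : X × X => (χ z.2 : ℝ≥0∞) := hχ'.comp measurable_snd
  rw [← h1, ← h2, Measure.fst, Measure.snd, lintegral_map hχ' measurable_fst,
    lintegral_map hχ' measurable_snd, ← lintegral_add_right _ hχ2,
    ← lintegral_const_mul' _ _ ENNReal.coe_ne_top]
  exact lintegral_mono fun z => by
    simp only [← ENNReal.coe_mul, ← ENNReal.coe_add]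
    exact ENNReal.coe_le_coe.2 (hcχ z.1 z.2)

lemma measure_le_exp_neg [IsProbabilityMeasure μ] (hα : ConvexClass α) {c : X → X → ℝ≥0}
    {a : ℝ≥0} (ha : 0 < a) (hT : TransportInequality α c μ a) {χ : X → ℝ≥0} (hχ : Measurable χ)
    {k M : ℝ≥0} (hcχ : ∀ x y, k * χ x ≤ c x y + χ y) (hM : ∫⁻ x, χ x ∂μ = M) (n : ℕ) :
    μ {x | (n : ℝ≥0∞) ≤ α ((k * χ x - M) / a)} ≤ ENNReal.ofReal (Real.exp (-n)) := by
  set S := {x | (n : ℝ≥0∞) ≤ α ((k * χ x - M) / a)} with hSdef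
  have hWm : Measurable fun x => α ((k * χ x - M) / a) :=
    hα.monotone.measurable.comp (((hχ.const_mul k).sub_const M).div_const a)
  have hS : MeasurableSet S := measurableSet_le measurable_const hWm
  rcases eq_or_ne (μ S) 0 with h0 | h0
  · rw [h0]; exact zero_le
  have hprob : IsProbabilityMeasure (ProbabilityTheory.cond μ S) :=
    ProbabilityTheory.cond_isProbabilityMeasure h0
  -- A point of S where χ is at most its conditional mean: there α is at least n, while monotonicity
  -- bounds it by α(T/a) ≤ -log μ(S).
  obtain ⟨x, hxS, hx⟩ := exists_le_setLAverage h0 (measure_ne_top μ S)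
    hχ.coe_nnreal_ennreal.aemeasurable
  rw [← lintegral_cond] at hx
  have h1 : (((k * χ x - M) / a : ℝ≥0) : ℝ≥0∞) ≤
      optCost c (ProbabilityTheory.cond μ S) μ / a := by
    rw [ENNReal.coe_div ha.ne', ENNReal.coe_sub, ENNReal.coe_mul]
    gcongr
    refine le_trans ?_ (mul_lintegral_sub_le_optCost hχ hcχ)
    rw [hM]
    gcongr
  have h2 : (n : ℝ≥0∞) ≤ ENNReal.ofReal (-Real.log (μ S).toReal) := by
    calc (n : ℝ≥0∞) ≤ α ((k * χ x - M) / a) := hxS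
      _ = extend α (((k * χ x - M) / a : ℝ≥0) : ℝ≥0∞) := by
        rw [extend, if_neg ENNReal.coe_ne_top, ENNReal.toNNReal_coe]
      _ ≤ extend α (optCost c (ProbabilityTheory.cond μ S) μ / a) := hα.extend_mono h1
      _ ≤ InformationTheory.klDiv (ProbabilityTheory.cond μ S) μ := hT _ hprob
      _ ≤ _ := klDiv_cond_le hS h0
  have hpos : 0 < (μ S).toReal := ENNReal.toReal_pos h0 (measure_ne_top μ S)
  have hle1 : (μ S).toReal ≤ 1 := by
    simpa using ENNReal.toReal_mono ENNReal.one_ne_top (prob_le_one (μ := μ) (s := S))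
  have hlog : 0 ≤ -Real.log (μ S).toReal := by
    have := Real.log_nonpos hpos.le hle1
    linarith
  have h3 : (n : ℝ) ≤ -Real.log (μ S).toReal := by
    have := ENNReal.toReal_mono ENNReal.ofReal_ne_top h2
    rwa [ENNReal.toReal_natCast, ENNReal.toReal_ofReal hlog] at this
  rw [← ENNReal.ofReal_toReal (measure_ne_top μ S)]
  refine ENNReal.ofReal_le_ofReal ?_
  rw [← Real.exp_log hpos]
  exact Real.exp_le_exp.2 (by linarith)

/-- Otherwise α would be infinite off 0 and α^⊛ would vanish. -/
lemma exists_pos_ne_top (hA2 : AssumptionA2 α) : ∃ B : ℝ≥0, 0 < B ∧ α B ≠ ⊤ := by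
  obtain ⟨s₀, κ, hs0, hκ, h⟩ := hA2
  by_contra! hc
  lift s₀ to ℝ≥0 using hs0.le
  have h1 : conj α s₀ ≤ 0 := by
    rw [conj_le_iff]
    intro t
    rcases eq_or_ne t 0 with rfl | ht
    · simp
    · simp [hc t (pos_iff_ne_zero.2 ht)]
  have h2 := (h s₀ le_rfl).trans h1
  rw [nonpos_iff_eq_zero, ENNReal.ofReal_eq_zero] at h2
  have : 0 < κ * (s₀ : ℝ) ^ 2 := by positivity
  linarith

/-- The term n = ⌊α w⌋ alone suffices. Midpoint convexity halves the exponent, so the weights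
e^{(n+1)/2} stay summable against tails e^{-n}. If α w = ∞, every term is present and the sum
diverges. -/
lemma expOf_half_le_tsum {w B r : ℝ≥0} (hα : ConvexClass α) (hB : α B ≠ ⊤)
    (hr : r ≤ 2⁻¹ * w + 2⁻¹ * B) :
    expOf α r ≤ ENNReal.ofReal (Real.exp ((α B).toReal / 2)) *
      ∑' n : ℕ, {v : ℝ≥0∞ | (n : ℝ≥0∞) ≤ v}.indicator
        (fun _ => ENNReal.ofReal (Real.exp ((n + 1) / 2))) (α w) := by
  rcases eq_or_ne (α w) ⊤ with hw | hw
  · have : ∑' n : ℕ, {v : ℝ≥0∞ | (n : ℝ≥0∞) ≤ v}.indicator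
        (fun _ => ENNReal.ofReal (Real.exp ((n + 1) / 2))) (α w) = ⊤ := by
      rw [hw, ← top_le_iff, ← ENNReal.tsum_const_eq_top_of_ne_zero (α := ℕ) one_ne_zero]
      refine ENNReal.tsum_le_tsum fun n => ?_
      rw [Set.indicator_of_mem (by simp)]
      rw [ENNReal.one_le_ofReal]
      exact Real.one_le_exp (by positivity)
    rw [this, ENNReal.mul_top (by simpa using Real.exp_pos _)]
    exact le_top
  · have h1 : α r ≤ ((2⁻¹ : ℝ≥0) : ℝ≥0∞) * α w + ((2⁻¹ : ℝ≥0) : ℝ≥0∞) * α B :=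
      (hα.monotone hr).trans (hα.le_combo (by rw [← two_mul]; simp) w B)
    have e1 : ((2⁻¹ : ℝ≥0) : ℝ≥0∞) * α w ≠ ⊤ := ENNReal.mul_ne_top ENNReal.coe_ne_top hw
    have e2 : ((2⁻¹ : ℝ≥0) : ℝ≥0∞) * α B ≠ ⊤ := ENNReal.mul_ne_top ENNReal.coe_ne_top hB
    have hne := ENNReal.add_ne_top.2 ⟨e1, e2⟩
    have h2 : (α r).toReal ≤ (α w).toReal / 2 + (α B).toReal / 2 := by
      have := ENNReal.toReal_mono hne h1
      rw [ENNReal.toReal_add e1 e2, ENNReal.toReal_mul, ENNReal.toReal_mul] at this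
      simp only [ENNReal.coe_toReal, NNReal.coe_inv, NNReal.coe_ofNat] at this
      linarith
    set n := ⌊(α w).toReal⌋₊ with hn
    have hnw : (n : ℝ≥0∞) ≤ α w := by
      rw [← ENNReal.ofReal_toReal hw, ← ENNReal.ofReal_natCast]
      exact ENNReal.ofReal_le_ofReal (Nat.floor_le ENNReal.toReal_nonneg)
    have hn' : (α w).toReal < n + 1 := Nat.lt_floor_add_one _
    rw [expOf_of_ne_top (ne_top_of_le_ne_top hne h1)]
    calc ENNReal.ofReal (Real.exp (α r).toReal)
        ≤ ENNReal.ofReal (Real.exp ((α B).toReal / 2) * Real.exp ((n + 1) / 2)) := by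
          rw [← Real.exp_add]
          exact ENNReal.ofReal_le_ofReal (Real.exp_le_exp.2 (by linarith))
      _ = ENNReal.ofReal (Real.exp ((α B).toReal / 2)) *
          {v : ℝ≥0∞ | (n : ℝ≥0∞) ≤ v}.indicator
            (fun _ => ENNReal.ofReal (Real.exp ((n + 1) / 2))) (α w) := by
        rw [ENNReal.ofReal_mul (Real.exp_pos _).le, Set.indicator_of_mem (by exact hnw)]
      _ ≤ _ := by
        gcongr
        exact ENNReal.le_tsum n

lemma memOrlicz_of_transportInequality [IsProbabilityMeasure μ] (hα : ConvexClass α)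
    (hA2 : AssumptionA2 α) {c : X → X → ℝ≥0} {a : ℝ≥0} (ha : 0 < a)
    (hT : TransportInequality α c μ a) {χ : X → ℝ≥0} (hχ : Measurable χ) {k M : ℝ≥0} (hk : 0 < k)
    (hcχ : ∀ x y, k * χ x ≤ c x y + χ y) (hM : ∫⁻ x, χ x ∂μ = M) :
    MemOrlicz α μ fun x => (χ x : ℝ) := by
  obtain ⟨B, hB0, hB⟩ := exists_pos_ne_top hA2
  -- With w = (kχ - M)⁺/a one has χ ≤ w·(a/k) + B·(M/(kB)), so this constant gives χ/l ≤ (w + B)/2.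
  refine ⟨hχ.coe_nnreal_real.aemeasurable, 2 * (a / k + M / (k * B)), by positivity, ?_⟩
  set l := 2 * (a / k + M / (k * B)) with hl
  have hl0 : 0 < l := by positivity
  have hWm : Measurable fun x => α ((k * χ x - M) / a) :=
    hα.monotone.measurable.comp (((hχ.const_mul k).sub_const M).div_const a)
  have hle : ∀ x, χ x / l ≤ 2⁻¹ * ((k * χ x - M) / a) + 2⁻¹ * B := by
    intro x
    rw [div_le_iff₀ hl0]
    have h1 : k * χ x ≤ (k * χ x - M) + M := le_tsub_add
    set w := (k * χ x - M) / a with hw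
    have hwa : k * χ x - M = a * w := by rw [hw, mul_div_cancel₀ _ ha.ne']
    rw [hwa] at h1
    calc χ x = (k * χ x) / k := by rw [mul_div_cancel_left₀ _ hk.ne']
      _ ≤ (a * w + M) / k := by gcongr
      _ = w * (a / k) + B * (M / (k * B)) := by field_simp
      _ ≤ w * (a / k + M / (k * B)) + B * (a / k + M / (k * B)) := by
        gcongr
        · exact le_self_add
        · exact le_add_self
      _ = (2⁻¹ * w + 2⁻¹ * B) * l := by rw [hl]; field_simp
  have hsum : Summable fun n : ℕ => Real.exp (1 / 2) * Real.exp (-1 / 2) ^ n :=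
    (summable_geometric_of_lt_one (Real.exp_pos _).le
      (by rw [← Real.exp_zero]; exact Real.exp_lt_exp.2 (by norm_num))).mul_left _
  calc ∫⁻ x, tau α (‖(χ x : ℝ)‖₊ / l) ∂μ ≤ ∫⁻ x, expOf α (χ x / l) ∂μ := by
        refine lintegral_mono fun x => ?_
        rw [NNReal.nnnorm_eq]
        exact tsub_le_self
    _ ≤ ∫⁻ x, ENNReal.ofReal (Real.exp ((α B).toReal / 2)) *
          ∑' n : ℕ, {v : ℝ≥0∞ | (n : ℝ≥0∞) ≤ v}.indicator
            (fun _ => ENNReal.ofReal (Real.exp ((n + 1) / 2))) (α ((k * χ x - M) / a)) ∂μ :=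
      lintegral_mono fun x => expOf_half_le_tsum hα hB (hle x)
    _ = ENNReal.ofReal (Real.exp ((α B).toReal / 2)) * ∑' n : ℕ,
          ENNReal.ofReal (Real.exp ((n + 1) / 2)) *
            μ {x | (n : ℝ≥0∞) ≤ α ((k * χ x - M) / a)} := by
      rw [lintegral_const_mul' _ _ ENNReal.ofReal_ne_top, lintegral_tsum]
      · congr 2
        ext n
        exact lintegral_indicator_const_comp (f := fun x => α ((k * χ x - M) / a)) hWm
          (measurableSet_le measurable_const measurable_id) _
      · intro n
        exact ((measurable_const.indicator
          (measurableSet_le measurable_const measurable_id)).comp hWm).aemeasurable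
    _ ≤ ENNReal.ofReal (Real.exp ((α B).toReal / 2)) * ∑' n : ℕ,
          ENNReal.ofReal (Real.exp (1 / 2) * Real.exp (-1 / 2) ^ n) := by
      gcongr with n
      calc _ ≤ ENNReal.ofReal (Real.exp ((n + 1) / 2)) * ENNReal.ofReal (Real.exp (-n)) := by
            gcongr
            exact measure_le_exp_neg hα ha hT hχ hcχ hM n
        _ = _ := by
          rw [← ENNReal.ofReal_mul (Real.exp_pos _).le, ← Real.exp_nat_mul, ← Real.exp_add,
            ← Real.exp_add]
          congr 2
          ring
    _ < ⊤ := ENNReal.mul_lt_top ENNReal.ofReal_lt_top hsum.tsum_ofReal_lt_top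

end Necessity

/-! ### Δ₂ costs, Luxemburg norms and the final bounds. -/

section Main

variable {X : Type*} [MeasurableSpace X] {μ ν : Measure X} {α : ℝ≥0 → ℝ≥0∞}

/-- x + y is the midpoint of 2x and 2y. -/
lemma Delta2With.map_add_le {q : ℝ≥0 → ℝ≥0} {K : ℝ} (hK : Delta2With q K)
    (hq : ConvexOn ℝ≥0 Set.univ q) (x y : ℝ≥0) : (q (x + y) : ℝ) ≤ K / 2 * (q x + q y) := by
  have h := hq.2 (Set.mem_univ (2 * x)) (Set.mem_univ (2 * y)) (zero_le (a := (2⁻¹ : ℝ≥0)))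
    (zero_le (a := (2⁻¹ : ℝ≥0))) (by rw [← two_mul]; simp)
  simp only [smul_eq_mul, inv_mul_cancel_left₀ (two_ne_zero : (2 : ℝ≥0) ≠ 0)] at h
  have h' : (q (x + y) : ℝ) ≤ 2⁻¹ * q (2 * x) + 2⁻¹ * q (2 * y) := by exact_mod_cast h
  linarith [hK.2 x, hK.2 y]

lemma Delta2With.coe_map_le {q : ℝ≥0 → ℝ≥0} {K : ℝ} (hK : Delta2With q K) (hq_mono : Monotone q)
    (hq : ConvexOn ℝ≥0 Set.univ q) {x y z : ℝ≥0} (h : z ≤ x + y) :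
    (q z : ℝ≥0∞) ≤ ENNReal.ofReal (K / 2) * (q x + q y) := by
  rw [← ENNReal.coe_add, ← ENNReal.ofReal_coe_nnreal, ← ENNReal.ofReal_coe_nnreal (p := q x + q y),
    ← ENNReal.ofReal_mul (half_pos hK.1).le]
  refine ENNReal.ofReal_le_ofReal ?_
  rw [NNReal.coe_add]
  exact (NNReal.coe_le_coe.2 (hq_mono h)).trans (hK.map_add_le hq x y)

lemma mConst_ne_zero_and_ne_top (hA1 : AssumptionA1 α) {s₀ κ u : ℝ}
    (hSQ : SuperQuadraticWith α s₀ κ) (hu : AdmissibleParam s₀ κ u) :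
    mConst α κ u ≠ 0 ∧ mConst α κ u ≠ ⊤ := by
  obtain ⟨s₁, C, -, -, hC0, hC, -⟩ := exists_eq_sqrt_two_mul_mConst hA1 hSQ hu
  constructor
  · intro h
    rw [h, mul_zero, ENNReal.coe_eq_zero] at hC
    exact hC0.ne' hC
  · intro h
    rw [h, ENNReal.mul_top (by simp)] at hC
    exact ENNReal.coe_ne_top hC

/-- A finite integral need not be at most 1; `exists_eq_expBound` rescales it. -/
lemma luxNorm_ne_top [IsProbabilityMeasure μ] (hα : ConvexClass α) {χ : X → ℝ≥0}
    (h : MemOrlicz α μ fun x => (χ x : ℝ)) : luxNorm α μ (fun x => (χ x : ℝ)) ≠ ⊤ := by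
  obtain ⟨-, l, hl, hfin⟩ := h
  simp only [NNReal.nnnorm_eq] at hfin
  have h1 : ∫⁻ x, expOf α (l⁻¹ * χ x) ∂μ ≠ ⊤ := by
    simp only [← div_eq_inv_mul]
    rw [lintegral_expOf_eq]
    exact ENNReal.add_ne_top.2 ⟨hfin.ne, ENNReal.one_ne_top⟩
  obtain ⟨l', hl', -, h2⟩ := exists_eq_expBound hα (inv_pos.2 hl) h1
  refine ne_top_of_le_ne_top (ENNReal.coe_ne_top (r := l')) (iInf₂_le l' ⟨hl', ?_⟩)
  simp only [NNReal.nnnorm_eq]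
  exact (lintegral_tau_le_one_iff _).2 h2

lemma exists_of_mul_iInf_luxNorm_lt [IsProbabilityMeasure μ] {c : X → X → ℝ≥0} {B T : ℝ≥0∞}
    (h : B * ⨅ x₀ : X, luxNorm α μ (fun x => (c x₀ x : ℝ)) < T) (hB0 : B ≠ 0) (hB : B ≠ ⊤) :
    ∃ (x₀ : X) (l : ℝ≥0), 0 < l ∧ ∫⁻ x, expOf α (c x₀ x / l) ∂μ ≤ 2 ∧ B * l ≤ T := by
  by_contra! hc
  refine absurd h (not_lt.2 ?_)
  rw [mul_comm, ← ENNReal.div_le_iff hB0 hB]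
  refine le_iInf fun x₀ => le_iInf₂ fun l hl => ?_
  simp only [NNReal.nnnorm_eq] at hl
  rw [ENNReal.div_le_iff hB0 hB, mul_comm]
  exact (hc x₀ l hl.1 ((lintegral_tau_le_one_iff _).1 hl.2)).le

lemma optCost_self [IsProbabilityMeasure μ] {c : X → X → ℝ≥0} (hc0 : ∀ x, c x x = 0) :
    optCost c μ μ = 0 := by
  have hdiag : Measurable fun x : X => (x, x) := measurable_id.prodMk measurable_id
  have hfst : (μ.map fun x => (x, x)).fst = μ := by
    rw [Measure.fst, Measure.map_map measurable_fst hdiag]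
    exact Measure.map_id
  have hsnd : (μ.map fun x => (x, x)).snd = μ := by
    rw [Measure.snd, Measure.map_map measurable_snd hdiag]
    exact Measure.map_id
  refine nonpos_iff_eq_zero.1 ?_
  calc optCost c μ μ ≤ ∫⁻ z, (c z.1 z.2 : ℝ≥0∞) ∂(μ.map fun x => (x, x)) :=
        iInf₂_le _ ⟨hfst, hsnd⟩
    _ ≤ ∫⁻ x, (c x x : ℝ≥0∞) ∂μ := lintegral_map_le _ _
    _ = 0 := by simp [hc0]

lemma ConvexClass.genInv_ne_zero (hα : ConvexClass α) {t : ℝ≥0} (ht0 : 0 < t) (ht : α t ≠ ⊤)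
    {H : ℝ≥0∞} (hH : H ≠ 0) : genInv α H ≠ 0 := by
  obtain ⟨h, hh0, hhH⟩ := ENNReal.lt_iff_exists_nnreal_btwn.1 (pos_iff_ne_zero.2 hH)
  have hh0 : 0 < h := by exact_mod_cast hh0
  have hαt := hα.map_mul_le (θ := h / (h + (α t).toNNReal)) (div_le_one_of_le₀ le_self_add zero_le)
    t
  have h1 : α (h / (h + (α t).toNNReal) * t) ≤ H := by
    refine hαt.trans (le_trans ?_ hhH.le)
    lift α t to ℝ≥0 using ht with v
    rw [← ENNReal.coe_mul, ENNReal.coe_le_coe, ENNReal.toNNReal_coe, div_mul_eq_mul_div,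
      div_le_iff₀ (by positivity)]
    gcongr
    exact le_add_self
  have h2 := le_genInv h1
  intro h0
  rw [h0, nonpos_iff_eq_zero, ENNReal.coe_eq_zero] at h2
  have : 0 < h / (h + (α t).toNNReal) * t := by positivity
  exact this.ne' h2

lemma exists_admissibleParam {s₀ κ : ℝ} (hs₀ : 0 < s₀) (hκ : 0 < κ) :
    ∃ u, AdmissibleParam s₀ κ u := by
  have hp : 0 < s₀ * √κ := mul_pos hs₀ (Real.sqrt_pos.2 hκ)
  refine ⟨min (1 / 2) (s₀ * √κ / 2), by positivity, ?_, ?_, ?_⟩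
  · exact (min_le_left _ _).trans_lt (by norm_num)
  · set u := min (1 / 2) (s₀ * √κ / 2)
    have h1 : u ≤ 1 / 2 := min_le_left _ _
    have h2 : u ≤ s₀ * √κ / 2 := min_le_right _ _
    have h3 : 1 / 2 ≤ √(1 - u) := Real.le_sqrt_of_sq_le (by norm_num; linarith)
    rw [div_le_iff₀ (by linarith)]
    nlinarith
  · set u := min (1 / 2) (s₀ * √κ / 2)
    have h0 : 0 < u := by positivity
    have h1 : u ≤ 1 / 2 := min_le_left _ _
    rw [div_le_iff₀ (by linarith)]
    have : u ^ 3 ≤ (1 / 2) ^ 3 := by gcongr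
    linarith

lemma transportInequality_luxNorm [IsProbabilityMeasure μ] (hα : ConvexClass α)
    (hA1 : AssumptionA1 α) {s₀ κ u : ℝ} (hSQ : SuperQuadraticWith α s₀ κ)
    (hu : AdmissibleParam s₀ κ u) {c : X → X → ℝ≥0} (hc0 : ∀ x, c x x = 0)
    (hcm : ∀ x₀, Measurable (c x₀)) {K : ℝ} (hK : 0 < K)
    (hcχ : ∀ x₀ x y, (c x y : ℝ≥0∞) ≤ ENNReal.ofReal (K / 2) * (c x₀ x + c x₀ y)) :
    TransportInequality α c μ (ENNReal.ofReal (√2 * K) * mConst α κ u *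
      ⨅ x₀ : X, luxNorm α μ (fun x => (c x₀ x : ℝ))) := by
  intro ν hν
  obtain ⟨hm0, hmt⟩ := mConst_ne_zero_and_ne_top hA1 hSQ hu
  refine hα.extend_div_le fun ρ hρ => ?_
  rcases eq_or_ne ρ 0 with rfl | hρ0
  · simp [hα.map_zero]
  have hK0 : ENNReal.ofReal (√2 * K) ≠ 0 := by
    rw [Ne, ENNReal.ofReal_eq_zero, not_le]; positivity
  rw [← mul_assoc] at hρ
  obtain ⟨x₀, l, hl, hexp, hle⟩ := exists_of_mul_iInf_luxNorm_lt hρ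
    (mul_ne_zero (by simpa using hρ0) (mul_ne_zero hK0 hm0))
    (ENNReal.mul_ne_top ENNReal.coe_ne_top (ENNReal.mul_ne_top ENNReal.ofReal_ne_top hmt))
  exact le_klDiv_of_mul_le_optCost hα hA1 hSQ hu hc0 (hcm x₀) hK (hcχ x₀) hl hexp
    (by rwa [← mul_assoc])

lemma optCost_le_expBound [IsProbabilityMeasure μ] [IsProbabilityMeasure ν] (hα : ConvexClass α)
    (hA1 : AssumptionA1 α) {s₀ κ u : ℝ} (hSQ : SuperQuadraticWith α s₀ κ)
    (hu : AdmissibleParam s₀ κ u) {c : X → X → ℝ≥0} (hc0 : ∀ x, c x x = 0)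
    (hcm : ∀ x₀, Measurable (c x₀)) {K : ℝ} (hK : 0 < K)
    (hcχ : ∀ x₀ x y, (c x y : ℝ≥0∞) ≤ ENNReal.ofReal (K / 2) * (c x₀ x + c x₀ y))
    (hfin : ∀ t, α t < ⊤) :
    optCost c ν μ ≤ ENNReal.ofReal (√2 * K) * mConst α κ u *
      ⨅ x₀ : X, ⨅ δ : ℝ≥0, ⨅ _ : 0 < δ,
        expBound α μ (fun x => c x₀ x) δ * genInv α (InformationTheory.klDiv ν μ) := by
  obtain ⟨hm0, hmt⟩ := mConst_ne_zero_and_ne_top hA1 hSQ hu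
  have hK0 : ENNReal.ofReal (√2 * K) ≠ 0 := by
    rw [Ne, ENNReal.ofReal_eq_zero, not_le]; positivity
  have hA0 : ENNReal.ofReal (√2 * K) * mConst α κ u ≠ 0 := mul_ne_zero hK0 hm0
  have hAt : ENNReal.ofReal (√2 * K) * mConst α κ u ≠ ⊤ :=
    ENNReal.mul_ne_top ENNReal.ofReal_ne_top hmt
  rw [mul_comm (ENNReal.ofReal (√2 * K) * mConst α κ u), ← ENNReal.div_le_iff hA0 hAt]
  refine le_iInf fun x₀ => le_iInf₂ fun δ hδ => ?_
  rw [ENNReal.div_le_iff hA0 hAt]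
  rcases eq_or_ne (∫⁻ x, expOf α (δ * c x₀ x) ∂μ) ⊤ with htop | htop
  · have hb : expBound α μ (fun x => c x₀ x) δ = ⊤ := by
      rw [expBound, htop, ENNReal.log_top, EReal.toENNReal_top,
        ENNReal.top_div_of_ne_top ENNReal.ofReal_ne_top, add_top, ENNReal.mul_top]
      simp
    -- The product ∞ · α⁻¹(H) is infinite unless H = 0, when ν = μ and the cost is 0.
    rcases eq_or_ne (InformationTheory.klDiv ν μ) 0 with hH | hH
    · rw [InformationTheory.klDiv_eq_zero_iff.1 hH, optCost_self hc0]
      exact zero_le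
    · rw [hb, ENNReal.top_mul (hα.genInv_ne_zero one_pos (hfin 1).ne hH), ENNReal.top_mul hA0]
      exact le_top
  · obtain ⟨l, hl, hlb, hexp⟩ := exists_eq_expBound hα hδ htop
    rw [← hlb, mul_comm (l : ℝ≥0∞), mul_assoc, mul_comm (l : ℝ≥0∞)]
    have hl0 : (l : ℝ≥0∞) ≠ 0 := by simpa using hl.ne'
    rw [← ENNReal.div_le_iff (mul_ne_zero hA0 hl0) (ENNReal.mul_ne_top hAt ENNReal.coe_ne_top)]
    refine ENNReal.le_of_forall_nnreal_lt fun ρ hρ => le_genInv ?_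
    exact le_klDiv_of_mul_le_optCost hα hA1 hSQ hu hc0 (hcm x₀) hK (hcχ x₀) hl hexp
      (ENNReal.mul_lt_of_lt_div hρ).le

end Main

end TransportCost

theorem mainTheorem2 {X : Type*} [MetricSpace X] [PolishSpace X] [MeasurableSpace X] [BorelSpace X]
    (q : ℝ≥0 → ℝ≥0) (hq_mono : Monotone q) (hq_conv : ConvexOn ℝ≥0 Set.univ q) (hq_zero : q 0 = 0)
    (hq_delta2 : ∃ K : ℝ, TransportCost.Delta2With q K)
    (c : X → X → ℝ≥0) (hc : ∀ x y : X, c x y = q (nndist x y))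
    (α : ℝ≥0 → ℝ≥0∞) (hα : TransportCost.ConvexClass α)
    (hA1 : TransportCost.AssumptionA1 α) (hA2 : TransportCost.AssumptionA2 α)
    (μ : Measure X) [IsProbabilityMeasure μ]
    (hμ : ∀ x₀ : X, Integrable (fun x => (c x₀ x : ℝ)) μ) :
    ((∃ a : ℝ≥0, 0 < a ∧ TransportCost.TransportInequality α c μ a) ↔
      ∀ x₀ : X, TransportCost.MemOrlicz α μ (fun x => (c x₀ x : ℝ))) ∧
    ∀ K : ℝ, TransportCost.Delta2With q K →
    ∀ s₀ κ : ℝ, TransportCost.SuperQuadraticWith α s₀ κ →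
    ∀ u : ℝ, TransportCost.AdmissibleParam s₀ κ u →
      ((∀ x₀ : X, TransportCost.MemOrlicz α μ (fun x => (c x₀ x : ℝ))) →
        ENNReal.ofReal (√2 * K) * TransportCost.mConst α κ u *
            (⨅ x₀ : X, TransportCost.luxNorm α μ (fun x => (c x₀ x : ℝ))) ≠ ⊤ ∧
        TransportCost.TransportInequality α c μ
          (ENNReal.ofReal (√2 * K) * TransportCost.mConst α κ u *
            ⨅ x₀ : X, TransportCost.luxNorm α μ (fun x => (c x₀ x : ℝ)))) ∧
      ((∀ t : ℝ≥0, α t < ⊤) →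
        ∀ ν : Measure X, IsProbabilityMeasure ν →
          TransportCost.optCost c ν μ ≤
            ENNReal.ofReal (√2 * K) * TransportCost.mConst α κ u *
              ⨅ x₀ : X, ⨅ δ : ℝ≥0, ⨅ _ : 0 < δ,
                TransportCost.expBound α μ (fun x => c x₀ x) δ *
                  TransportCost.genInv α (InformationTheory.klDiv ν μ)) := by
  have hc0 : ∀ x, c x x = 0 := fun x => by rw [hc, nndist_self, hq_zero]
  have hcm : ∀ x₀, Measurable (c x₀) := fun x₀ => by
    have : c x₀ = fun x => q (nndist x₀ x) := funext fun x => hc x₀ x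
    rw [this]
    exact hq_mono.measurable.comp (measurable_const.nndist measurable_id)
  have hcχ : ∀ K : ℝ, TransportCost.Delta2With q K → ∀ x₀ x y,
      (c x y : ℝ≥0∞) ≤ ENNReal.ofReal (K / 2) * (c x₀ x + c x₀ y) := fun K hK x₀ x y => by
    rw [hc, hc, hc]
    exact hK.coe_map_le hq_mono hq_conv (nndist_comm x₀ x ▸ nndist_triangle x x₀ y)
  have hupper : ∀ K : ℝ, TransportCost.Delta2With q K →
      ∀ s₀ κ : ℝ, TransportCost.SuperQuadraticWith α s₀ κ →
      ∀ u : ℝ, TransportCost.AdmissibleParam s₀ κ u →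
      (∀ x₀ : X, TransportCost.MemOrlicz α μ (fun x => (c x₀ x : ℝ))) →
        ENNReal.ofReal (√2 * K) * TransportCost.mConst α κ u *
            (⨅ x₀ : X, TransportCost.luxNorm α μ (fun x => (c x₀ x : ℝ))) ≠ ⊤ ∧
        TransportCost.TransportInequality α c μ
          (ENNReal.ofReal (√2 * K) * TransportCost.mConst α κ u *
            ⨅ x₀ : X, TransportCost.luxNorm α μ (fun x => (c x₀ x : ℝ))) := by
    intro K hK s₀ κ hSQ u hu hmem
    refine ⟨?_, TransportCost.transportInequality_luxNorm hα hA1 hSQ hu hc0 hcm hK.1 (hcχ K hK)⟩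
    obtain ⟨x₀⟩ := nonempty_of_isProbabilityMeasure μ
    exact ENNReal.mul_ne_top (ENNReal.mul_ne_top ENNReal.ofReal_ne_top
      (TransportCost.mConst_ne_zero_and_ne_top hA1 hSQ hu).2)
      (ne_top_of_le_ne_top (TransportCost.luxNorm_ne_top hα (hmem x₀)) (iInf_le _ x₀))
  refine ⟨⟨?_, fun hmem => ?_⟩, fun K hK s₀ κ hSQ u hu => ⟨hupper K hK s₀ κ hSQ u hu,
    fun hfin ν hν => TransportCost.optCost_le_expBound hα hA1 hSQ hu hc0 hcm hK.1 (hcχ K hK)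
      hfin⟩⟩
  · rintro ⟨a, ha, hT⟩ x₀
    obtain ⟨K, hK⟩ := hq_delta2
    have hM : ∫⁻ x, c x₀ x ∂μ ≠ ⊤ := by
      have := (hμ x₀).lintegral_lt_top.ne
      simpa only [ENNReal.ofReal_coe_nnreal] using this
    lift K to ℝ≥0 using hK.1.le
    have hK0 : 0 < K := hK.1
    -- The quasi-triangle inequality solved for c(x₀,x): (2/K) c(x₀,x) ≤ c(x,y) + c(x₀,y).
    refine TransportCost.memOrlicz_of_transportInequality hα hA2 ha hT (hcm x₀) (k := 2 / K)
      (by positivity) (fun x y => ?_) (ENNReal.coe_toNNReal hM).symm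
    have h := hK.map_add_le hq_conv (nndist x y) (nndist x₀ y)
    have h1 : (q (nndist x₀ x) : ℝ) ≤ K / 2 * (q (nndist x y) + q (nndist x₀ y)) := by
      refine le_trans (NNReal.coe_le_coe.2 (hq_mono ?_)) h
      rw [add_comm, nndist_comm x y]
      exact nndist_triangle x₀ y x
    rw [hc, hc, hc, ← NNReal.coe_le_coe]
    push_cast
    rw [div_mul_eq_mul_div, div_le_iff₀ (by exact_mod_cast hK0)]
    linarith
  · obtain ⟨K, hK⟩ := hq_delta2
    obtain ⟨s₀, κ, hSQ⟩ := hA2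
    obtain ⟨u, hu⟩ := TransportCost.exists_admissibleParam hSQ.1 hSQ.2.1
    obtain ⟨hfin, hT⟩ := hupper K hK s₀ κ hSQ u hu hmem
    lift ENNReal.ofReal (√2 * K) * TransportCost.mConst α κ u *
      (⨅ x₀ : X, TransportCost.luxNorm α μ (fun x => (c x₀ x : ℝ))) to ℝ≥0 using hfin with a ha
    -- The explicit constant may be 0; enlarging it weakens the inequality and makes it positive.
    refine ⟨a + 1, by positivity, fun ν hν => (hα.extend_mono ?_).trans (hT ν hν)⟩
    gcongr
    exact le_self_add
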